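/- **Setting.** Let $S$ be a string of length $n\ge 2$ over an alphabet of size $\sigma\ge 2$. A full grammar $(S',G)$ consists of a starting string $S'$ and rules $X\to \mathrm{rhs}(X)$ for the nonterminals $X$ of $G$ (the start symbol is not counted among them); its size is $|S'|+\sum_X|\mathrm{rhs}(X)|$, and $S_G$ denotes the concatenation of $S'$ and all right-hand sides. The algorithm Greedy starts with $(S,\emptyset)$. In each round it chooses a word $w$, $|w|\ge 2$, with at least two disjoint occurrences in the starting string and the right-hand sides, replaces $w$ there by a fresh nonterminal $X$ (scanning each of them from left to right), and adds the rule $X\to w$; $w$ is chosen so that the resulting full grammar is as small as possible, with ties broken arbitrarily. Greedy ends when there is no such word. For a word $w$ let $|w|_v$ be the number of (possibly overlapping) occurrences of $v$ in $w$, $|w|_\epsilon=|w|$, and $$H_k(w)=-\frac1{|w|}\sum_{|v|=k,\ a\text{ a letter}}|w|_{va}\log_2\frac{|w|_{va}}{|w|_v},$$ where summands with $|w|_{va}=0$ or $|w|_v=0$ are $0$. The bit-size of the entropy coding of $(S',G)$ is $|S_G|H_0(S_G)+\sum_X|\mathrm{rhs}(X)|$: the string $S_G$ is entropy coded, and the length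 of each $\mathrm{rhs}(X)$ is stored in unary. **Theorem.** Let $\sigma=\sigma(n)\ge 2$ and let $k=k(n)\ge 0$ be an integer with $k=o(\log_\sigma n)$ as $n\to\infty$. There is a function $\mathrm{err}(n)=o(n\log\sigma)$, depending only on the functions $\sigma$ and $k$, such that for every $n\ge 2$, every string $S$ of length $n$ over an alphabet of size $\sigma$ and every execution of Greedy on $S$: 1. at some moment of the execution the size of the full grammar is strictly below $\frac{64n}{\log_\sigma n}$; 2. at the first such moment the number of nonterminals of $G$ is at most $\sqrt n\,\log_\sigma n+3$; 3. at the first such moment the bit-size of the entropy coding of $(S',G)$ is at most $|S|H_k(S)+\mathrm{err}(n)$, i.e. at most $|S|H_k(S)+o(|S|\log\sigma)$. -/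

import Mathlib

open Filter Asymptotics

universe u

namespace GreedyGrammar

/-! ### Empirical entropy -/

section Entropy

variable {α : Type u} [DecidableEq α]

/-- `occ w v` is the number of (possibly overlapping) occurrences of `v` in `w`, counted by
starting position. For the empty word this gives `occ w [] = w.length`. -/
def occ (w v : List α) : ℕ :=
  ((Finset.range w.length).filter (fun i => v <+: w.drop i)).card

/-- The `k`-th order empirical entropy, in bits. The outer sum is over all words `v` of length `k`
over the letters of `w` and the inner one over the letters `a` of `w`; the summands of other
words and letters are zero, and so are those with `occ w (v ++ [a]) = 0`. -/
noncomputable def empiricalEntropy (k : ℕ) (w : List α) : ℝ :=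
  -(1 / (w.length : ℝ)) *
    ∑ v ∈ Fintype.piFinset (fun _ : Fin k => w.toFinset), ∑ a ∈ w.toFinset,
      (occ w (List.ofFn v ++ [a]) : ℝ) *
        Real.logb 2 ((occ w (List.ofFn v ++ [a]) : ℝ) / (occ w (List.ofFn v) : ℝ))

end Entropy

/-! ### Full grammars -/

/-- Symbols: a letter `Sum.inl a`, or the nonterminal `Sum.inr i` with number `i`. -/
abbrev Symbol (Γ : Type u) : Type u := Γ ⊕ ℕ

/-- A full grammar `(S', G)`: the starting string `S'`, and the list of the right-hand sides of the
rules of `G`; the nonterminal `Sum.inr i` has the right-hand side `rules[i]`. -/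
structure FullGrammar (Γ : Type u) where
  start : List (Symbol Γ)
  rules : List (List (Symbol Γ))

/-- Left-to-right replacement of the occurrences of `w` by the symbol `x`: the line is scanned from
the left; whenever `w` starts at the current position it is replaced and the scan continues after
that occurrence. -/
def replaceWord {α : Type u} [DecidableEq α] (w : List α) (x : α) : List α → List α
  | [] => []
  | a :: l =>
    if w <+: a :: l then x :: replaceWord w x (l.drop (w.length - 1))
    else a :: replaceWord w x l
  termination_by l => l.length
  decreasing_by all_goals simp

/-- The number of (pairwise disjoint) occurrences of `w` that this scan replaces. For nonempty `w`
it is the largest possible number of pairwise disjoint occurrences. -/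
def disjointOcc {α : Type u} [DecidableEq α] (w : List α) : List α → ℕ
  | [] => 0
  | a :: l =>
    if w <+: a :: l then disjointOcc w (l.drop (w.length - 1)) + 1
    else disjointOcc w l
  termination_by l => l.length
  decreasing_by all_goals simp

namespace FullGrammar

variable {Γ : Type u}

/-- All right-hand sides concatenated, the starting string included. -/
def rhs (g : FullGrammar Γ) : List (Symbol Γ) := g.start ++ g.rules.flatten

/-- The size `|S'| + |rhs(G)|` of a full grammar. -/
def size (g : FullGrammar Γ) : ℕ := g.rhs.length

/-- The number of nonterminals of `G` (the start symbol is not counted). -/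
def numNonterminals (g : FullGrammar Γ) : ℕ := g.rules.length

/-- The full grammar `(S, ∅)` with which the algorithm starts. -/
def initial (S : List Γ) : FullGrammar Γ := ⟨S.map Sum.inl, []⟩

/-- The bit-size of the entropy coding of `(S', G)`: `|S_G| H_0(S_G)` bits for the concatenation
`S_G` of the starting string and all right-hand sides, and the length of the right-hand side of
every nonterminal, in unary. -/
noncomputable def entropyCodingBits [DecidableEq Γ] (g : FullGrammar Γ) : ℝ :=
  (g.rhs.length : ℝ) * empiricalEntropy 0 g.rhs + ((g.rules.map List.length).sum : ℝ)

/-- One round with the word `w`: in the starting string and in all right-hand sides `w` is replaced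
by a fresh nonterminal, for which a rule with right-hand side `w` is added. -/
def replace [DecidableEq Γ] (g : FullGrammar Γ) (w : List (Symbol Γ)) : FullGrammar Γ where
  start := replaceWord w (Sum.inr g.rules.length) g.start
  rules := g.rules.map (replaceWord w (Sum.inr g.rules.length)) ++ [w]

/-- The number of disjoint occurrences of `w` in the starting string and the right-hand sides. -/
def frequency [DecidableEq Γ] (g : FullGrammar Γ) (w : List (Symbol Γ)) : ℕ :=
  disjointOcc w g.start + (g.rules.map (disjointOcc w)).sum

/-- `w` is a candidate for replacement: it has length at least two and at least two disjoint
occurrences. -/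
def Replaceable [DecidableEq Γ] (g : FullGrammar Γ) (w : List (Symbol Γ)) : Prop :=
  2 ≤ w.length ∧ 2 ≤ g.frequency w

/-- A round of Greedy: a candidate is replaced for which the resulting full grammar is smallest
possible (ties are broken arbitrarily). -/
def GreedyStep [DecidableEq Γ] (g g' : FullGrammar Γ) : Prop :=
  ∃ w, g.Replaceable w ∧ g' = g.replace w ∧
    ∀ w', g.Replaceable w' → (g.replace w).size ≤ (g.replace w').size

/-- `g 0, g 1, …` is an execution of Greedy on `S`: rounds are performed as long as there is a
candidate; when there is none, the algorithm has ended and the sequence stays constant. -/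
def IsGreedyRun [DecidableEq Γ] (S : List Γ) (g : ℕ → FullGrammar Γ) : Prop :=
  g 0 = initial S ∧
    ∀ i, GreedyStep (g i) (g (i + 1)) ∨
      ((∀ w, ¬ (g i).Replaceable w) ∧ g (i + 1) = g i)

end FullGrammar

end GreedyGrammar

/-! Uniqueness of parses. Throughout an execution two factors of the grammar with the same expansion
are equal, provided a complete right-hand side does not count as a factor of its rule
(`Parses.det`). The left-to-right scan preserves this (`Parses.replace`), so distinct symbols have
distinct expansions. Unfolding every nonterminal once (`Parses.exists_unfolding`) shows that `S_G`
is, up to order, a factorization `T` of `S` together with one extra copy of each nonterminal.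

Size. Symbols with expansions of length at least `ℓ` occur at most `n/ℓ` times in `T`, and fewer
than `σ^ℓ` symbols have shorter ones. If every pair has frequency at most `F` and there are `r`
nonterminals, the size is therefore `O(σ^(2ℓ) F + n/ℓ + r)` (`Parses.size_le`). With `ℓ` about
`(log_σ n)/4` one has `σ^(2ℓ) ≤ √n`, so a grammar of size at least `64n/log_σ n` with few
nonterminals has a pair of frequency at least `√n/log_σ n + 2` (`gain_of_large`). Greedy saves at
least as much as this pair would, that is `√n/log_σ n` per round; as at most `n` can be saved, the
grammar stays large for at most `√n log_σ n` rounds.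

Entropy. By Gibbs' inequality `|S_G| H_0(S_G)` is at most the code length of `S_G` under any
subprobability on the symbols. Take the average of the uniform weight `1/|S_G|` and the probability
of the expansion in a `k`-th order model of `S` that stops with probability `1 - θ`. The factors in
`T` cost `|S| H_k(S)` in total, plus `k log σ` and the stopping cost per factor, and `-log θ` per
letter; each extra nonterminal costs about `log |S_G|` bits (`Parses.entropyCodingBits_le`). With `1
- θ = 1/(log_σ n + 2)` the excess, unary lengths included, is `o(n log σ)`. -/

namespace GreedyGrammar

/-! ### Replacement of a word by a fresh symbol -/

section Replacement

variable {α : Type u} [DecidableEq α]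

/-- The substitution of the word `w` for the symbol `x`. -/
def unreplace (w : List α) (x : α) (l : List α) : List α :=
  l.flatMap fun y => if y = x then w else [y]

@[simp] lemma unreplace_nil (w : List α) (x : α) : unreplace w x [] = [] := rfl

lemma unreplace_cons (w : List α) (x y : α) (l : List α) :
    unreplace w x (y :: l) = (if y = x then w else [y]) ++ unreplace w x l := rfl

lemma unreplace_append (w : List α) (x : α) (l m : List α) :
    unreplace w x (l ++ m) = unreplace w x l ++ unreplace w x m := by
  simp [unreplace]

lemma unreplace_of_notMem (w : List α) (x : α) (l : List α) (h : x ∉ l) :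
    unreplace w x l = l := by
  induction l with
  | nil => rfl
  | cons a l ih =>
    simp only [List.mem_cons, not_or] at h
    rw [unreplace_cons, ih h.2, if_neg (Ne.symm h.1)]
    rfl

lemma replaceWord_cons_of_prefix {w : List α} {x a : α} {l : List α} (h : w <+: a :: l) :
    replaceWord w x (a :: l) = x :: replaceWord w x (l.drop (w.length - 1)) := by
  rw [replaceWord, if_pos h]

lemma replaceWord_cons_of_not_prefix {w : List α} {x a : α} {l : List α} (h : ¬ w <+: a :: l) :
    replaceWord w x (a :: l) = a :: replaceWord w x l := by
  rw [replaceWord, if_neg h]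

lemma eq_append_drop_of_prefix {α : Type*} {w : List α} (hw : w ≠ []) {a : α} {l : List α}
    (h : w <+: a :: l) : a :: l = w ++ l.drop (w.length - 1) := by
  obtain ⟨t, ht⟩ := h
  cases w with
  | nil => exact absurd rfl hw
  | cons b w =>
    simp only [List.cons_append, List.cons.injEq] at ht
    obtain ⟨rfl, rfl⟩ := ht
    simp

lemma replaceWord_append_left {w : List α} (hw : w ≠ []) (x : α) (l : List α) :
    replaceWord w x (w ++ l) = x :: replaceWord w x l := by
  cases w with
  | nil => exact absurd rfl hw
  | cons b w =>
    rw [List.cons_append, replaceWord_cons_of_prefix (by simp)]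
    simp

lemma replaceWord_of_length_lt {w : List α} (x : α) (l : List α) (h : l.length < w.length) :
    replaceWord w x l = l := by
  induction l with
  | nil => rw [replaceWord]
  | cons a l ih =>
    have hn : ¬ w <+: a :: l := fun hp => absurd hp.length_le (by omega)
    rw [replaceWord_cons_of_not_prefix hn, ih (by simp at h; omega)]

lemma unreplace_replaceWord {w : List α} (hw : w ≠ []) (x : α) (l : List α) (hx : x ∉ l) :
    unreplace w x (replaceWord w x l) = l := by
  induction l using replaceWord.induct (w := w) with
  | case1 => simp [replaceWord]
  | case2 a l h ih =>
    have e := eq_append_drop_of_prefix hw h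
    rw [replaceWord_cons_of_prefix h, unreplace_cons, if_pos rfl, ih, ← e]
    intro hm
    exact hx (e ▸ List.mem_append_right _ hm)
  | case3 a l h ih =>
    simp only [List.mem_cons, not_or] at hx
    rw [replaceWord_cons_of_not_prefix h, unreplace_cons, if_neg (Ne.symm hx.1), ih hx.2]
    rfl

lemma length_replaceWord (w : List α) (x : α) (l : List α) :
    (replaceWord w x l).length + disjointOcc w l * (w.length - 1) = l.length := by
  induction l using replaceWord.induct (w := w) with
  | case1 => simp [replaceWord, disjointOcc]
  | case2 a l h ih =>
    have hl := h.length_le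
    rw [replaceWord_cons_of_prefix h, disjointOcc, if_pos h]
    simp only [List.length_drop, List.length_cons, add_mul, one_mul] at *
    omega
  | case3 a l h ih =>
    rw [replaceWord_cons_of_not_prefix h, disjointOcc, if_neg h]
    simp only [List.length_cons] at *
    omega

lemma infix_of_disjointOcc_pos {w : List α} (l : List α) (h : 0 < disjointOcc w l) :
    w <:+: l := by
  induction l with
  | nil => simp [disjointOcc] at h
  | cons a l ih =>
    rw [disjointOcc] at h
    split_ifs at h with hp
    · exact hp.isInfix
    · exact (ih h).trans (List.suffix_cons a l).isInfix

lemma mem_replaceWord_of_disjointOcc_pos {w : List α} (x : α) (l : List α)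
    (h : 0 < disjointOcc w l) : x ∈ replaceWord w x l := by
  induction l with
  | nil => simp [disjointOcc] at h
  | cons a l ih =>
    rw [disjointOcc] at h
    split_ifs at h with hp
    · rw [replaceWord_cons_of_prefix hp]
      simp
    · rw [replaceWord_cons_of_not_prefix hp]
      exact List.mem_cons_of_mem _ (ih h)

lemma disjointOcc_self {w : List α} (hw : w ≠ []) : disjointOcc w w = 1 := by
  cases w with
  | nil => exact absurd rfl hw
  | cons a w =>
    rw [disjointOcc, if_pos List.prefix_rfl]
    simp [disjointOcc]

/-- The scan only looks ahead. Cutting the line at a boundary of the parse cuts no replaced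
occurrence, and it creates none, since an occurrence in the cut line is one in the full line. -/
lemma replaceWord_unreplace_of_prefix {w : List α} (hw : w ≠ []) (x : α) (l : List α)
    (hx : x ∉ l) (u : List α) (hu : u <+: replaceWord w x l) :
    replaceWord w x (unreplace w x u) = u := by
  induction l using replaceWord.induct (w := w) generalizing u with
  | case1 =>
    rw [replaceWord, List.prefix_nil] at hu
    subst hu
    simp [replaceWord]
  | case2 a l h ih =>
    have e := eq_append_drop_of_prefix hw h
    rw [replaceWord_cons_of_prefix h] at hu
    cases u with
    | nil => simp [replaceWord]
    | cons b u =>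
      rw [List.cons_prefix_cons] at hu
      obtain ⟨rfl, hu⟩ := hu
      rw [unreplace_cons, if_pos rfl, replaceWord_append_left hw, ih _ u hu]
      intro hm
      exact hx (e ▸ List.mem_append_right _ hm)
  | case3 a l h ih =>
    have hr := unreplace_replaceWord hw x (a :: l) hx
    simp only [List.mem_cons, not_or] at hx
    rw [replaceWord_cons_of_not_prefix h] at hu hr
    cases u with
    | nil => simp [replaceWord]
    | cons b u =>
      have hp : unreplace w x (b :: u) <+: a :: l := by
        obtain ⟨t, ht⟩ := hu
        rw [← hr, ← ht, unreplace_append]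
        exact List.prefix_append _ _
      rw [List.cons_prefix_cons] at hu
      obtain ⟨rfl, hu⟩ := hu
      rw [unreplace_cons, if_neg (Ne.symm hx.1)] at hp ⊢
      rw [List.singleton_append, replaceWord_cons_of_not_prefix, ih hx.2 u hu]
      exact fun hq => h (hq.trans hp)

/-- The scan has no memory: from any boundary on, it acts as if started there. -/
lemma exists_suffix_of_suffix_replaceWord {w : List α} (x : α) (l : List α)
    (v : List α) (hv : v <:+ replaceWord w x l) :
    ∃ l', l' <:+ l ∧ v = replaceWord w x l' := by
  induction l using replaceWord.induct (w := w) with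
  | case1 =>
    rw [replaceWord, List.suffix_nil] at hv
    exact ⟨[], List.suffix_rfl, by simp [hv, replaceWord]⟩
  | case2 a l h ih =>
    rw [replaceWord_cons_of_prefix h, List.suffix_cons_iff] at hv
    rcases hv with rfl | hv
    · exact ⟨_, List.suffix_rfl, (replaceWord_cons_of_prefix h).symm⟩
    · obtain ⟨l', h1, h2⟩ := ih hv
      exact ⟨l', (h1.trans (List.drop_suffix _ _)).trans (List.suffix_cons _ _), h2⟩
  | case3 a l h ih =>
    rw [replaceWord_cons_of_not_prefix h, List.suffix_cons_iff] at hv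
    rcases hv with rfl | hv
    · exact ⟨_, List.suffix_rfl, (replaceWord_cons_of_not_prefix h).symm⟩
    · obtain ⟨l', h1, h2⟩ := ih hv
      exact ⟨l', h1.trans (List.suffix_cons _ _), h2⟩

/-- The scan is determined by the replaced factor alone: it parses the same word between two
boundaries in the same way wherever it occurs. -/
lemma replaceWord_unreplace_of_infix {w : List α} (hw : w ≠ []) (x : α) (l : List α)
    (hx : x ∉ l) (u : List α) (hu : u <:+: replaceWord w x l) :
    replaceWord w x (unreplace w x u) = u := by
  obtain ⟨v, hv1, hv2⟩ := List.infix_iff_prefix_suffix.1 hu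
  obtain ⟨l', h1, rfl⟩ := exists_suffix_of_suffix_replaceWord x l v hv2
  exact replaceWord_unreplace_of_prefix hw x l' (fun h => hx (h1.mem h)) u hv1

lemma unreplace_infix {w : List α} (hw : w ≠ []) (x : α) (l : List α)
    (hx : x ∉ l) (u : List α) (hu : u <:+: replaceWord w x l) :
    unreplace w x u <:+: l := by
  obtain ⟨s, t, h⟩ := hu
  refine ⟨unreplace w x s, unreplace w x t, ?_⟩
  rw [← unreplace_append, ← unreplace_append, h, unreplace_replaceWord hw x l hx]

lemma unreplace_ne_nil {w : List α} (hw : w ≠ []) (x : α) {u : List α} (hu : u ≠ []) :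
    unreplace w x u ≠ [] := by
  cases u with
  | nil => exact absurd rfl hu
  | cons a u =>
    rw [unreplace_cons]
    split_ifs <;> simp [hw]

lemma length_unreplace_lt {w : List α} (hw : w ≠ []) (x : α) (l : List α)
    (hx : x ∉ l) (u : List α) (hu : u <:+: replaceWord w x l)
    (hlt : u.length < (replaceWord w x l).length) : (unreplace w x u).length < l.length := by
  obtain ⟨s, t, h⟩ := hu
  have hst : s ++ t ≠ [] := by
    intro h0
    rw [List.append_eq_nil_iff] at h0
    rw [← h, h0.1, h0.2] at hlt
    simp at hlt
  have h1 := List.length_pos_of_ne_nil (unreplace_ne_nil hw x hst)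
  have h2 := unreplace_replaceWord hw x l hx
  rw [← h, unreplace_append, unreplace_append] at h2
  rw [← h2]
  rw [unreplace_append] at h1
  simp only [List.length_append] at *
  omega

end Replacement

/-! ### Invariant of the rounds: uniqueness of parses -/

namespace FullGrammar

variable {Γ : Type u}

/-- The expansion of a symbol when the nonterminal `Sum.inr i` expands to `e i`. -/
def expand (e : ℕ → List Γ) : Symbol Γ → List Γ := Sum.elim (fun a => [a]) e

/-- `u` is a factor of the starting string or a proper factor of a right-hand side of a rule. -/
def InnerFactor (g : FullGrammar Γ) (u : List (Symbol Γ)) : Prop :=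
  u <:+: g.start ∨ ∃ l ∈ g.rules, u <:+: l ∧ u.length < l.length

/-- `g` is a grammar for `S` whose nonterminals expand to `e`, without useless symbols and unit
rules, in which every word has at most one parse. -/
structure Parses (S : List Γ) (g : FullGrammar Γ) (e : ℕ → List Γ) : Prop where
  start_eq : g.start.flatMap (expand e) = S
  rule_eq : ∀ i l, g.rules[i]? = some l → l.flatMap (expand e) = e i
  two_le : ∀ l ∈ g.rules, 2 ≤ l.length
  lt_of_mem : ∀ i, Sum.inr i ∈ g.rhs → i < g.rules.length
  mem : ∀ i, i < g.rules.length → Sum.inr i ∈ g.rhs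
  ne_nil : ∀ i, i < g.rules.length → e i ≠ []
  det : ∀ u v, g.InnerFactor u → g.InnerFactor v →
    u.flatMap (expand e) = v.flatMap (expand e) → u = v

lemma parses_initial (S : List Γ) : Parses S (initial S) (fun _ => []) where
  start_eq := by simp [initial, expand, List.flatMap_map]
  rule_eq := by simp [initial]
  two_le := by simp [initial]
  lt_of_mem := by simp [initial, rhs]
  mem := by simp [initial]
  ne_nil := by simp [initial]
  det := by
    intro u v hu hv h
    have key : ∀ u : List (Symbol Γ), (initial S).InnerFactor u →
        (u.flatMap (expand fun _ => [])).map Sum.inl = u := by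
      rintro u (⟨s, t, h⟩ | ⟨l, hl, -⟩)
      · have hm : ∀ y ∈ u, ∃ a, y = Sum.inl a := by
          intro y hy
          have : y ∈ S.map Sum.inl := by
            change s ++ u ++ t = S.map Sum.inl at h
            rw [← h]
            simp [hy]
          simp only [List.mem_map] at this
          obtain ⟨a, -, rfl⟩ := this
          exact ⟨a, rfl⟩
        clear h
        induction u with
        | nil => rfl
        | cons y u ih =>
          obtain ⟨a, rfl⟩ := hm y (by simp)
          have := ih fun y hy => hm y (by simp [hy])
          simp [expand] at this ⊢
          exact this
      · simp [initial] at hl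
    rw [← key u hu, ← key v hv, h]

variable {S : List Γ} {g : FullGrammar Γ} {e : ℕ → List Γ}

lemma mem_rhs {y : Symbol Γ} : y ∈ g.rhs ↔ y ∈ g.start ∨ ∃ l ∈ g.rules, y ∈ l := by
  simp [rhs]

lemma Parses.innerFactor_singleton (h : Parses S g e) {y : Symbol Γ} (hy : y ∈ g.rhs) :
    g.InnerFactor [y] := by
  rcases mem_rhs.1 hy with hy | ⟨l, hl, hy⟩
  · exact Or.inl ((List.singleton_infix_iff _ _).2 hy)
  · exact Or.inr ⟨l, hl, (List.singleton_infix_iff _ _).2 hy, h.two_le l hl⟩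

lemma Parses.expand_injOn (h : Parses S g e) {x y : Symbol Γ} (hx : x ∈ g.rhs) (hy : y ∈ g.rhs)
    (hxy : expand e x = expand e y) : x = y := by
  have := h.det [x] [y] (h.innerFactor_singleton hx) (h.innerFactor_singleton hy)
    (by simpa using hxy)
  simpa using this

lemma Parses.expand_ne_nil (h : Parses S g e) {y : Symbol Γ} (hy : y ∈ g.rhs) :
    expand e y ≠ [] := by
  cases y with
  | inl a => simp [expand]
  | inr i => exact h.ne_nil i (h.lt_of_mem i hy)

variable [DecidableEq Γ]

lemma exists_line_of_frequency_pos {w : List (Symbol Γ)} (h : 0 < g.frequency w) :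
    0 < disjointOcc w g.start ∨ ∃ l ∈ g.rules, 0 < disjointOcc w l := by
  by_contra! hc
  have : (g.rules.map (disjointOcc w)).sum = 0 := by
    rw [List.sum_eq_zero_iff]
    intro n hn
    obtain ⟨l, hl, rfl⟩ := List.mem_map.1 hn
    exact Nat.le_zero.1 (hc.2 l hl)
  unfold frequency at h
  omega

lemma sum_map_le_one {β : Type*} [DecidableEq β] (f : β → ℕ) (w : β) (L : List β)
    (hf : ∀ l ∈ L, l ≠ w → f l = 0) (hw : f w ≤ 1)
    (huniq : ∀ a b : ℕ, L[a]? = some w → L[b]? = some w → a = b) : (L.map f).sum ≤ 1 := by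
  have hcount : L.count w ≤ 1 := by
    by_contra! hc
    have hd : List.Duplicate w L := List.duplicate_iff_two_le_count.2 hc
    rw [List.duplicate_iff_exists_distinct_get] at hd
    obtain ⟨a, b, hab, ha, hb⟩ := hd
    have := huniq a b (by simp [ha]) (by simp [hb])
    exact absurd hab (by simp [Fin.lt_def, this])
  have hsum : ∀ L : List β, (∀ l ∈ L, l ≠ w → f l = 0) → (L.map f).sum ≤ L.count w := by
    intro L
    induction L with
    | nil => simp
    | cons l L ih =>
      intro hL
      have := ih fun l hl => hL l (by simp [hl])
      rw [List.map_cons, List.sum_cons, List.count_cons]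
      by_cases hlw : l = w
      · subst hlw
        simp
        omega
      · have h0 := hL l (by simp) hlw
        omega
  exact (hsum L hf).trans hcount

/-- A replaceable word is not the right-hand side of a rule. -/
lemma Parses.not_mem_rules (h : Parses S g e) {w : List (Symbol Γ)} (hw : g.Replaceable w) :
    w ∉ g.rules := by
  intro hmem
  have hw0 : w ≠ [] := by
    rintro rfl
    exact absurd hw.1 (by simp)
  obtain ⟨i, hi⟩ := List.mem_iff_getElem?.1 hmem
  have hir : i < g.rules.length := (List.getElem?_eq_some_iff.1 hi).1
  -- Otherwise `w` and its own nonterminal would be two parses of the same word. So `w` occurs only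
  -- as a complete right-hand side, and only one rule can have it.
  have hni : ¬ g.InnerFactor w := by
    intro hin
    have := h.det w [Sum.inr i] hin (h.innerFactor_singleton (h.mem i hir))
      (by rw [h.rule_eq i w hi]; simp [expand])
    have h2 := hw.1
    rw [this] at h2
    simp at h2
  have hst : disjointOcc w g.start = 0 := by
    by_contra h0
    exact hni (Or.inl (infix_of_disjointOcc_pos _ (Nat.pos_of_ne_zero h0)))
  have hru : ∀ l ∈ g.rules, l ≠ w → disjointOcc w l = 0 := by
    intro l hl hlw
    by_contra h0
    have hin := infix_of_disjointOcc_pos l (Nat.pos_of_ne_zero h0)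
    refine hni (Or.inr ⟨l, hl, hin, lt_of_le_of_ne hin.length_le fun hlen => hlw ?_⟩)
    exact (hin.eq_of_length hlen).symm
  have huniq : ∀ a b : ℕ, g.rules[a]? = some w → g.rules[b]? = some w → a = b := by
    intro a b ha hb
    have hal : a < g.rules.length := (List.getElem?_eq_some_iff.1 ha).1
    have hbl : b < g.rules.length := (List.getElem?_eq_some_iff.1 hb).1
    have := h.expand_injOn (h.mem a hal) (h.mem b hbl)
      (by change e a = e b; rw [← h.rule_eq a w ha, ← h.rule_eq b w hb])
    simpa using this
  have := hw.2
  unfold frequency at this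
  have hsum := sum_map_le_one (disjointOcc w) w g.rules hru (disjointOcc_self hw0).le huniq
  omega

lemma expand_update_unreplace {i : ℕ} {w : List (Symbol Γ)}
    (u : List (Symbol Γ)) :
    u.flatMap (expand (Function.update e i (w.flatMap (expand e)))) =
      (unreplace w (Sum.inr i) u).flatMap (expand e) := by
  induction u with
  | nil => rfl
  | cons y u ih =>
    rw [List.flatMap_cons, ih, unreplace_cons, List.flatMap_append]
    congr 1
    split_ifs with hy
    · subst hy
      simp [expand]
    · cases y with
      | inl a => simp [expand]
      | inr j =>
        have : j ≠ i := fun h => hy (by rw [h])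
        simp [expand, this]

/-- One round with any replaceable word keeps the grammar a parse of `S`. -/
lemma Parses.replace (h : Parses S g e) {w : List (Symbol Γ)} (hw : g.Replaceable w) :
    Parses S (g.replace w) (Function.update e g.rules.length (w.flatMap (expand e))) := by
  have hw0 : w ≠ [] := by
    rintro rfl
    exact absurd hw.1 (by simp)
  set r := g.rules.length with hr
  have hfresh : (Sum.inr r : Symbol Γ) ∉ g.rhs := fun hm => absurd (h.lt_of_mem r hm) (by omega)
  have hfs : (Sum.inr r : Symbol Γ) ∉ g.start := fun hm => hfresh (mem_rhs.2 (Or.inl hm))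
  have hfr : ∀ l ∈ g.rules, (Sum.inr r : Symbol Γ) ∉ l :=
    fun l hl hm => hfresh (mem_rhs.2 (Or.inr ⟨l, hl, hm⟩))
  have hinf : w <:+: g.start ∨ ∃ l ∈ g.rules, w <:+: l := by
    rcases exists_line_of_frequency_pos (lt_of_lt_of_le two_pos hw.2) with h1 | ⟨l, hl, h1⟩
    · exact Or.inl (infix_of_disjointOcc_pos _ h1)
    · exact Or.inr ⟨l, hl, infix_of_disjointOcc_pos _ h1⟩
  have hwsub : ∀ y ∈ w, y ∈ g.rhs := by
    intro y hy
    rcases hinf with h1 | ⟨l, hl, h1⟩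
    · exact mem_rhs.2 (Or.inl (h1.mem hy))
    · exact mem_rhs.2 (Or.inr ⟨l, hl, h1.mem hy⟩)
  have hfw : (Sum.inr r : Symbol Γ) ∉ w := fun hm => hfresh (hwsub _ hm)
  have hrules : ∀ l, l ∈ (g.replace w).rules ↔
      (∃ l' ∈ g.rules, replaceWord w (Sum.inr r) l' = l) ∨ l = w := by
    intro l
    simp [FullGrammar.replace, hr]
  have hlen : (g.replace w).rules.length = r + 1 := by simp [FullGrammar.replace, hr]
  have hline : ∀ l, (Sum.inr r : Symbol Γ) ∉ l →
      (replaceWord w (Sum.inr r) l).flatMap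
        (expand (Function.update e r (w.flatMap (expand e)))) = l.flatMap (expand e) := by
    intro l hl
    rw [expand_update_unreplace, unreplace_replaceWord hw0 _ _ hl]
  have hmemline : ∀ l, (Sum.inr r : Symbol Γ) ∉ l → ∀ y ∈ l,
      y ∈ replaceWord w (Sum.inr r) l ∨ y ∈ w := by
    intro l hl y hy
    rw [← unreplace_replaceWord hw0 _ _ hl] at hy
    simp only [unreplace, List.mem_flatMap] at hy
    obtain ⟨z, hz, hy⟩ := hy
    split_ifs at hy with hzr
    · exact Or.inr hy
    · rw [List.mem_singleton] at hy
      exact Or.inl (hy ▸ hz)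
  have hmemline' : ∀ l, (Sum.inr r : Symbol Γ) ∉ l → ∀ y ∈ replaceWord w (Sum.inr r) l,
      y = Sum.inr r ∨ y ∈ l := by
    intro l hl y hy
    by_cases hyr : y = Sum.inr r
    · exact Or.inl hyr
    · refine Or.inr ?_
      rw [← unreplace_replaceWord hw0 _ _ hl]
      simp only [unreplace, List.mem_flatMap]
      exact ⟨y, hy, by simp [hyr]⟩
  refine ⟨?_, ?_, ?_, ?_, ?_, ?_, ?_⟩
  · exact (hline _ hfs).trans h.start_eq
  · intro i l hl
    simp only [FullGrammar.replace] at hl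
    rcases lt_trichotomy i r with hi | hi | hi
    · rw [List.getElem?_append_left (by simpa using hi), List.getElem?_map] at hl
      obtain ⟨l', hl', rfl⟩ := Option.map_eq_some_iff.1 hl
      rw [hline l' (hfr l' (List.mem_of_getElem? hl')), h.rule_eq i l' hl',
        Function.update_of_ne hi.ne]
    · subst hi
      rw [List.getElem?_append_right (by simp [hr])] at hl
      simp [hr] at hl
      subst hl
      rw [Function.update_self, expand_update_unreplace, unreplace_of_notMem _ _ _ hfw]
    · rw [List.getElem?_eq_none (by simp; omega)] at hl
      simp at hl
  · intro l hl
    rcases (hrules l).1 hl with ⟨l', hl', rfl⟩ | rfl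
    -- A rule of length at least two can shrink to a single symbol only if it equals `w`, which
    -- `not_mem_rules` excludes.
    · by_contra! hlt
      have hun := unreplace_replaceWord hw0 (Sum.inr r) l' (hfr l' hl')
      have h2 := h.two_le l' hl'
      match hrep : replaceWord w (Sum.inr r) l', hlt with
      | [], _ =>
        rw [hrep] at hun
        rw [← hun] at h2
        simp at h2
      | [y], _ =>
        rw [hrep, unreplace_cons] at hun
        split_ifs at hun with hy
        · simp at hun
          exact h.not_mem_rules hw (hun ▸ hl')
        · rw [← hun] at h2
          simp at h2
      | y :: z :: t, hlt =>
        simp at hlt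
    · exact hw.1
  · intro i hi
    rw [hlen]
    rcases mem_rhs.1 hi with hi | ⟨l, hl, hi⟩
    · rcases hmemline' _ hfs _ hi with hi | hi
      · simp at hi
        omega
      · have := h.lt_of_mem i (mem_rhs.2 (Or.inl hi))
        omega
    · rcases (hrules l).1 hl with ⟨l', hl', rfl⟩ | rfl
      · rcases hmemline' _ (hfr l' hl') _ hi with hi | hi
        · simp at hi
          omega
        · have := h.lt_of_mem i (mem_rhs.2 (Or.inr ⟨l', hl', hi⟩))
          omega
      · rename_i hi'
        have := h.lt_of_mem i (hwsub _ hi')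
        omega
  · intro i hi
    rw [hlen] at hi
    by_cases hir : i = r
    · subst hir
      rcases exists_line_of_frequency_pos (lt_of_lt_of_le two_pos hw.2) with h1 | ⟨l, hl, h1⟩
      · exact mem_rhs.2 (Or.inl (mem_replaceWord_of_disjointOcc_pos _ _ h1))
      · exact mem_rhs.2 (Or.inr ⟨_, (hrules _).2 (Or.inl ⟨l, hl, rfl⟩),
          mem_replaceWord_of_disjointOcc_pos _ _ h1⟩)
    · have hmw : (Sum.inr i : Symbol Γ) ∈ w → Sum.inr i ∈ (g.replace w).rhs :=
        fun hm => mem_rhs.2 (Or.inr ⟨w, (hrules w).2 (Or.inr rfl), hm⟩)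
      rcases mem_rhs.1 (h.mem i (by omega)) with hm | ⟨l, hl, hm⟩
      · rcases hmemline _ hfs _ hm with hm | hm
        · exact mem_rhs.2 (Or.inl hm)
        · exact hmw hm
      · rcases hmemline _ (hfr l hl) _ hm with hm | hm
        · exact mem_rhs.2 (Or.inr ⟨_, (hrules _).2 (Or.inl ⟨l, hl, rfl⟩), hm⟩)
        · exact hmw hm
  · intro i hi
    rw [hlen] at hi
    by_cases hir : i = r
    · subst hir
      rw [Function.update_self]
      obtain ⟨y, t, rfl⟩ := List.exists_cons_of_ne_nil hw0
      rw [List.flatMap_cons]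
      simp [h.expand_ne_nil (hwsub y (by simp))]
    · rw [Function.update_of_ne hir]
      exact h.ne_nil i (by omega)
  -- A new factor is recovered by scanning its preimage, an old factor with the same expansion; so
  -- uniqueness carries over.
  · have key : ∀ u, (g.replace w).InnerFactor u →
        g.InnerFactor (unreplace w (Sum.inr r) u) ∧
          replaceWord w (Sum.inr r) (unreplace w (Sum.inr r) u) = u := by
      rintro u (hu | ⟨l, hl, hu, hlt⟩)
      · exact ⟨Or.inl (unreplace_infix hw0 _ _ hfs u hu),
          replaceWord_unreplace_of_infix hw0 _ _ hfs u hu⟩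
      · rcases (hrules l).1 hl with ⟨l', hl', rfl⟩ | rfl
        · exact ⟨Or.inr ⟨l', hl', unreplace_infix hw0 _ _ (hfr l' hl') u hu,
            length_unreplace_lt hw0 _ _ (hfr l' hl') u hu hlt⟩,
            replaceWord_unreplace_of_infix hw0 _ _ (hfr l' hl') u hu⟩
        -- A proper factor of the new rule is too short to contain `w`, so the scan leaves it alone.
        -- The full right-hand side would be scanned to the fresh nonterminal; this is why
        -- `InnerFactor` demands properness.
        · rw [unreplace_of_notMem _ _ _ fun hm => hfw (hu.mem hm)]
          refine ⟨?_, replaceWord_of_length_lt _ _ hlt⟩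
          rcases hinf with h1 | ⟨l', hl', h1⟩
          · exact Or.inl (hu.trans h1)
          · exact Or.inr ⟨l', hl', hu.trans h1, lt_of_lt_of_le hlt h1.length_le⟩
    intro u v hu hv huv
    rw [expand_update_unreplace, expand_update_unreplace] at huv
    rw [← (key u hu).2, ← (key v hv).2, h.det _ _ (key u hu).1 (key v hv).1 huv]

end FullGrammar

/-! ### Words of bounded length -/

section Words

variable (Γ : Type u) [Fintype Γ] [DecidableEq Γ]

/-- The words of length at most `N`. -/
def wordsUpTo : ℕ → Finset (List Γ)
  | 0 => {[]}
  | N + 1 => insert [] ((Finset.univ ×ˢ wordsUpTo N).image fun p => p.1 :: p.2)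

variable {Γ}

lemma mem_wordsUpTo (N : ℕ) (l : List Γ) (h : l.length ≤ N) : l ∈ wordsUpTo Γ N := by
  induction N generalizing l with
  | zero => simp [wordsUpTo, List.length_eq_zero_iff.1 (Nat.le_zero.1 h)]
  | succ N ih =>
    cases l with
    | nil => simp [wordsUpTo]
    | cons a l => simp [wordsUpTo, ih l (by simpa using h)]

lemma sum_wordsUpTo_succ {M : Type*} [AddCommMonoid M] (N : ℕ) (f : List Γ → M) :
    ∑ l ∈ wordsUpTo Γ (N + 1), f l = f [] + ∑ a, ∑ l ∈ wordsUpTo Γ N, f (a :: l) := by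
  rw [wordsUpTo, Finset.sum_insert (by simp), Finset.sum_image, Finset.sum_product]
  rintro ⟨a, l⟩ - ⟨b, m⟩ - h
  simpa using h

lemma card_wordsUpTo_lt (hσ : 2 ≤ Fintype.card Γ) (N : ℕ) :
    (wordsUpTo Γ N).card + 1 ≤ Fintype.card Γ ^ (N + 1) := by
  induction N with
  | zero => simpa [wordsUpTo] using hσ
  | succ N ih =>
    have h1 : (wordsUpTo Γ (N + 1)).card = 1 + Fintype.card Γ * (wordsUpTo Γ N).card := by
      rw [Finset.card_eq_sum_ones, sum_wordsUpTo_succ]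
      simp
    have h2 := Nat.mul_le_mul_left (Fintype.card Γ) ih
    rw [h1, pow_succ']
    nlinarith

end Words

/-! ### Adjacent pairs -/

section Pairs

/-- A nonempty line has one pair fewer than letters, and each bad letter spoils at most two pairs.
-/
lemma length_le_filter_pairs {α : Type u} (p : α → Bool) (l : List α) :
    l.length ≤ ((l.zip l.tail).filter fun q => p q.1 && p q.2).length +
      2 * l.countP (fun a => !p a) + 1 := by
  cases l with
  | nil => simp
  | cons a l =>
    -- Strengthened for the induction: a bad first letter lies in at most one pair.
    have key : (a :: l).length + (if p a then 0 else 1) ≤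
        (((a :: l).zip l).filter fun q => p q.1 && p q.2).length +
          2 * (a :: l).countP (fun a => !p a) + 1 := by
      induction l generalizing a with
      | nil => cases h : p a <;> simp [h]
      | cons b l ih =>
        have := ih b
        rw [List.zip_cons_cons, List.filter_cons, List.countP_cons]
        rw [List.length_cons]
        cases ha : p a <;> cases hb : p b <;> simp [hb] at this ⊢ <;> omega
    simp only [List.tail_cons]
    omega

lemma length_le_card_mul {β : Type*} [DecidableEq β] (P : List β) (A : Finset β) (F : ℕ)
    (hA : ∀ x ∈ P, x ∈ A) (hF : ∀ x ∈ A, P.countP (fun y => y = x) ≤ F) :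
    P.length ≤ A.card * F := by
  have h1 := Multiset.sum_count_eq_card (s := A) (m := (P : Multiset β)) (by simpa using hA)
  rw [Multiset.coe_card] at h1
  rw [← h1, ← smul_eq_mul]
  refine Finset.sum_le_card_nsmul _ _ _ fun x hx => le_trans (le_of_eq ?_) (hF x hx)
  rw [Multiset.coe_count, List.count]
  congr

variable {α : Type u} [DecidableEq α]

/-- Occurrences of a pair overlap only in runs of one letter. A replaced occurrence accounts for
itself and at most for the one starting at its second letter. -/
lemma countP_pairs_le (a b : α) (l : List α) :
    (l.zip l.tail).countP (fun p => p = (a, b)) ≤ 2 * disjointOcc [a, b] l := by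
  induction l using replaceWord.induct (w := [a, b]) with
  | case1 => simp
  | case2 c l h ih =>
    rw [disjointOcc, if_pos h]
    obtain ⟨t, ht⟩ := h
    simp only [List.cons_append, List.nil_append, List.cons.injEq] at ht
    obtain ⟨rfl, rfl⟩ := ht
    simp only [List.length_cons, List.length_nil, List.tail_cons] at ih ⊢
    change ((t.zip t.tail).countP _ ≤ 2 * disjointOcc _ t) at ih
    change _ ≤ 2 * (disjointOcc [a, b] t + 1)
    have h1 : ((b :: t).zip t).countP (fun p => p = (a, b)) ≤
        (t.zip t.tail).countP (fun p => p = (a, b)) + 1 := by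
      cases t with
      | nil => simp
      | cons d t =>
        rw [List.zip_cons_cons, List.countP_cons]
        simp only [List.tail_cons]
        split_ifs <;> omega
    rw [List.zip_cons_cons, List.countP_cons]
    split_ifs <;> omega
  | case3 c l h ih =>
    rw [disjointOcc, if_neg h]
    cases l with
    | nil => simp
    | cons d l =>
      simp only [List.tail_cons] at ih ⊢
      rw [List.zip_cons_cons, List.countP_cons, if_neg, add_zero]
      · exact ih
      · simp only [decide_eq_true_eq, Prod.mk.injEq]
        rintro ⟨rfl, rfl⟩
        exact h (by simp)

end Pairs

/-! ### Unfolding a grammar; size of a grammar without frequent pairs -/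

namespace FullGrammar

variable {Γ : Type u} {S : List Γ} {g : FullGrammar Γ} {e : ℕ → List Γ}

lemma length_flatMap_ge {α β : Type*} (f : α → List β) (l : List α) (h : ∀ y ∈ l, f y ≠ []) :
    l.length ≤ (l.flatMap f).length := by
  induction l with
  | nil => simp
  | cons a l ih =>
    have h1 := List.length_pos_of_ne_nil (h a (by simp))
    have h2 := ih fun y hy => h y (by simp [hy])
    simp only [List.flatMap_cons, List.length_append, List.length_cons]
    omega

/-- Unfolding every nonterminal once turns the grammar into a factorization of `S`. -/
lemma Parses.exists_unfolding (h : Parses S g e) :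
    ∃ T : List (Symbol Γ), T.flatMap (expand e) = S ∧
      (T ++ (List.range g.rules.length).map Sum.inr).Perm g.rhs := by
  classical
  set r := g.rules.length with hr
  -- Nonterminals are unfolded one by one, at one occurrence each, in order of decreasing expansion
  -- length; `U` holds those already done.
  have key : ∀ m ≤ r, ∃ U ⊆ Finset.range r, U.card = m ∧ ∃ T : List (Symbol Γ),
      T.flatMap (expand e) = S ∧
      (T : Multiset (Symbol Γ)) + U.val.map Sum.inr =
        (g.start : Multiset (Symbol Γ)) +
          ∑ i ∈ U, ((g.rules.getD i [] : List (Symbol Γ)) : Multiset (Symbol Γ)) := by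
    intro m
    induction m with
    | zero => exact fun _ => ⟨∅, by simp, rfl, g.start, h.start_eq, by simp⟩
    | succ m ih =>
      intro hm
      obtain ⟨U, hU, hUm, T, hT, hTU⟩ := ih (by omega)
      have hne : (Finset.range r \ U).Nonempty := by
        rw [← Finset.card_pos, Finset.card_sdiff_of_subset hU, Finset.card_range]
        omega
      obtain ⟨x, hx, hmax⟩ := Finset.exists_max_image _ (fun i => (e i).length) hne
      rw [Finset.mem_sdiff, Finset.mem_range] at hx
      have hrule : ∀ i (hi : i < r), g.rules[i]? = some (g.rules.getD i []) := by
        intro i hi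
        simp [hr ▸ hi]
      -- If `x` occurs in the rule of `j`, then `j` has a strictly longer expansion, hence is
      -- already in `U`. So `x` is on the right side of the balance, and on the left it can only be
      -- in `T`.
      have hxT : (Sum.inr x : Symbol Γ) ∈ T := by
        have h1 : (Sum.inr x : Symbol Γ) ∈ (g.start : Multiset (Symbol Γ)) +
          ∑ i ∈ U, ((g.rules.getD i [] : List (Symbol Γ)) : Multiset (Symbol Γ)) := by
          rw [Multiset.mem_add, Multiset.mem_sum]
          rcases mem_rhs.1 (h.mem x hx.1) with hs | ⟨l, hl, hs⟩
          · exact Or.inl hs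
          · refine Or.inr ?_
            obtain ⟨j, hj⟩ := List.mem_iff_getElem?.1 hl
            have hjr : j < r := (List.getElem?_eq_some_iff.1 hj).1
            have hjl : g.rules.getD j [] = l := by
              have := hrule j hjr
              rw [hj] at this
              simpa using this.symm
            refine ⟨j, ?_, by rw [hjl]; exact hs⟩
            by_contra hjU
            have hle := hmax j (by simp [hjr, hjU])
            obtain ⟨A, B, rfl⟩ := List.append_of_mem hs
            have hsub : ∀ y ∈ A ++ B, expand e y ≠ [] := fun y hy =>
              h.expand_ne_nil (mem_rhs.2 (Or.inr ⟨_, hl, by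
                simp only [List.mem_append, List.mem_cons] at hy ⊢; tauto⟩))
            have h2 := length_flatMap_ge _ _ hsub
            have h3 := h.two_le _ hl
            have h4 := congrArg List.length (h.rule_eq j _ hj)
            have h5 : expand e (Sum.inr x : Symbol Γ) = e x := rfl
            simp only [List.flatMap_append, List.flatMap_cons, List.length_append,
              List.length_cons, h5] at h2 h3 h4 hle
            omega
        rw [← hTU, Multiset.mem_add] at h1
        rcases h1 with h1 | h1
        · exact h1
        · simp [hx.2] at h1
      obtain ⟨A, B, rfl⟩ := List.append_of_mem hxT
      refine ⟨insert x U, ?_, by rw [Finset.card_insert_of_notMem hx.2, hUm],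
        A ++ g.rules.getD x [] ++ B, ?_, ?_⟩
      · exact Finset.insert_subset (by simpa using hx.1) hU
      · rw [← hT]
        simp only [List.flatMap_append, List.flatMap_cons, h.rule_eq x _ (hrule x hx.1)]
        simp [expand]
      · rw [Finset.insert_val_of_notMem hx.2, Finset.sum_insert hx.2, Multiset.map_cons]
        rw [← Multiset.coe_add, ← Multiset.cons_coe] at hTU
        simp only [← Multiset.coe_add]
        rw [add_left_comm, ← hTU]
        simp only [← Multiset.singleton_add]
        abel
  obtain ⟨U, hU, hUr, T, hT, hTU⟩ := key r le_rfl
  obtain rfl : U = Finset.range r :=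
    Finset.eq_of_subset_of_card_le hU (by rw [Finset.card_range, hUr])
  refine ⟨T, hT, ?_⟩
  rw [← Multiset.coe_eq_coe, ← Multiset.coe_add, rhs, ← Multiset.coe_add]
  have h1 : ((List.map Sum.inr (List.range r) : List (Symbol Γ)) : Multiset (Symbol Γ)) =
      (Finset.range r).val.map Sum.inr := rfl
  rw [h1, hTU]
  congr 1
  have h2 : ∀ L : List (List (Symbol Γ)), ∑ i ∈ Finset.range L.length,
      ((L.getD i [] : List (Symbol Γ)) : Multiset (Symbol Γ)) =
      (L.flatten : Multiset (Symbol Γ)) := by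
    intro L
    induction L with
    | nil => rfl
    | cons l L ih =>
      rw [List.length_cons, Finset.sum_range_succ', List.flatten_cons, ← Multiset.coe_add, ← ih,
        add_comm]
      rfl
  exact h2 g.rules

lemma length_le_of_lines (p : Symbol Γ → Bool) (L : List (List (Symbol Γ))) :
    L.flatten.length ≤ ((L.flatMap fun l => l.zip l.tail).filter
      fun q => p q.1 && p q.2).length + 2 * L.flatten.countP (fun a => !p a) + L.length := by
  induction L with
  | nil => simp
  | cons l L ih =>
    have := length_le_filter_pairs p l
    simp only [List.flatten_cons, List.length_append, List.flatMap_cons, List.filter_append,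
      List.countP_append, List.length_cons]
    omega

variable [DecidableEq Γ]

lemma size_replace (g : FullGrammar Γ) (w : List (Symbol Γ)) :
    (g.replace w).size + g.frequency w * (w.length - 1) = g.size + w.length := by
  have h1 := length_replaceWord w (Sum.inr g.rules.length) g.start
  have h2 : ∀ L : List (List (Symbol Γ)),
      (L.map (replaceWord w (Sum.inr g.rules.length))).flatten.length +
        (L.map (disjointOcc w)).sum * (w.length - 1) = L.flatten.length := by
    intro L
    induction L with
    | nil => simp
    | cons l L ih =>
      have := length_replaceWord w (Sum.inr g.rules.length) l
      simp only [List.map_cons, List.flatten_cons, List.length_append, List.sum_cons, add_mul]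
      omega
  have h3 := h2 g.rules
  unfold size rhs frequency replace
  simp only [List.flatten_append, List.length_append, List.flatten_cons, List.flatten_nil,
    List.append_nil, add_mul]
  omega

lemma countP_lines_le (a b : Symbol Γ) (L : List (List (Symbol Γ))) :
    (L.flatMap fun l => l.zip l.tail).countP (fun p => p = (a, b)) ≤
      2 * (L.map (disjointOcc [a, b])).sum := by
  induction L with
  | nil => simp
  | cons l L ih =>
    have := countP_pairs_le a b l
    simp only [List.flatMap_cons, List.countP_append, List.map_cons, List.sum_cons]
    omega

lemma countP_mul_le {α β : Type*} (f : α → List β) (ℓ : ℕ) (l : List α) :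
    l.countP (fun y => !decide ((f y).length < ℓ)) * ℓ ≤ (l.flatMap f).length := by
  induction l with
  | nil => simp
  | cons a l ih =>
    rw [List.countP_cons, List.flatMap_cons, List.length_append, add_mul]
    by_cases h : (f a).length < ℓ
    · rw [if_neg (by simpa using h)]
      omega
    · rw [if_pos (by simpa using h)]
      omega

/-- If no pair of symbols is frequent, then the grammar is small: there are few pairs of symbols
with short expansions, and few occurrences of symbols with long ones. -/
lemma Parses.size_le [Fintype Γ] (h : Parses S g e) (hσ : 2 ≤ Fintype.card Γ) (F : ℕ)
    (hF : ∀ a b, g.frequency [a, b] ≤ F) (ℓ : ℕ) :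
    ∃ c, c * (ℓ + 1) ≤ S.length ∧
      g.size ≤ Fintype.card Γ ^ (2 * (ℓ + 1)) * (2 * F) +
        2 * (c + g.rules.length) + (g.rules.length + 1) := by
  obtain ⟨T, hT, hperm⟩ := h.exists_unfolding
  set p : Symbol Γ → Bool := fun y => decide ((expand e y).length < ℓ + 1) with hp
  refine ⟨T.countP fun y => !p y, by rw [← hT]; exact countP_mul_le _ _ _, ?_⟩
  have h1 := length_le_of_lines p (g.start :: g.rules)
  set P := (((g.start :: g.rules).flatMap fun l => l.zip l.tail).filter
    fun q => p q.1 && p q.2) with hP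
  -- Long symbols within `T` are limited by `|S|`; the extra copies number at most one per rule.
  have h2 : g.rhs.countP (fun y => !p y) ≤
      T.countP (fun y => !p y) + g.rules.length := by
    rw [← hperm.countP_eq, List.countP_append]
    exact Nat.add_le_add_left (List.countP_le_length.trans (by simp)) _
  set A := g.rhs.toFinset.filter (fun y => p y) with hA
  have hAc : A.card ≤ Fintype.card Γ ^ (ℓ + 1) := by
    refine le_trans ?_ (le_trans (Nat.le_succ _) (card_wordsUpTo_lt hσ ℓ))
    refine Finset.card_le_card_of_injOn (expand e) ?_ ?_
    · intro y hy
      simp only [hA, hp, Finset.coe_filter, Set.mem_ofPred_eq, decide_eq_true_eq] at hy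
      exact mem_wordsUpTo _ _ (by omega)
    · intro x hx y hy hxy
      simp only [hA, Finset.coe_filter, Set.mem_ofPred_eq, List.mem_toFinset] at hx hy
      exact h.expand_injOn hx.1 hy.1 hxy
  have hPl : P.length ≤ (A ×ˢ A).card * (2 * F) := by
    refine length_le_card_mul P (A ×ˢ A) _ ?_ ?_
    · rintro ⟨a, b⟩ hab
      simp only [hP, List.mem_filter, List.mem_flatMap, Bool.and_eq_true] at hab
      obtain ⟨⟨l, hl, hab⟩, ha, hb⟩ := hab
      have hsub : ∀ y ∈ l, y ∈ g.rhs := by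
        intro y hy
        rcases List.mem_cons.1 hl with rfl | hl
        · exact mem_rhs.2 (Or.inl hy)
        · exact mem_rhs.2 (Or.inr ⟨l, hl, hy⟩)
      have hm := List.of_mem_zip hab
      simp only [hA, Finset.mem_product, Finset.mem_filter, List.mem_toFinset]
      exact ⟨⟨hsub a hm.1, ha⟩, hsub b (List.mem_of_mem_tail hm.2), hb⟩
    · rintro ⟨a, b⟩ -
      refine (List.Sublist.countP_le List.filter_sublist).trans ?_
      refine (countP_lines_le a b (g.start :: g.rules)).trans ?_
      exact Nat.mul_le_mul_left 2 (hF a b)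
  have h3 : (A ×ˢ A).card * (2 * F) ≤ Fintype.card Γ ^ (2 * (ℓ + 1)) * (2 * F) := by
    refine Nat.mul_le_mul_right _ ?_
    rw [Finset.card_product, two_mul (ℓ + 1), pow_add]
    exact Nat.mul_le_mul hAc hAc
  have h4 : g.size = (g.start :: g.rules).flatten.length := rfl
  have h5 : g.rhs = (g.start :: g.rules).flatten := rfl
  rw [← h5, List.length_cons] at h1
  rw [h4, ← h5]
  omega

end FullGrammar

/-! ### Occurrences -/

section Occurrences

variable {α : Type u} [DecidableEq α]

lemma occ_cons (b : α) (l u : List α) :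
    occ (b :: l) u = (if u <+: b :: l then 1 else 0) + occ l u := by
  simp only [occ, Finset.card_filter, List.length_cons]
  rw [Finset.sum_range_succ', add_comm]
  simp

lemma occ_nil (u : List α) : occ [] u = 0 := by simp [occ]

lemma occ_empty_word (l : List α) : occ l [] = l.length := by simp [occ]

lemma occ_singleton (a : α) (l : List α) : occ l [a] = l.count a := by
  induction l with
  | nil => simp [occ_nil]
  | cons b l ih =>
    rw [occ_cons, ih, List.count_cons, add_comm]
    by_cases h : a = b
    · simp [h]
    · simp [h, Ne.symm h]

lemma occ_pos {l u : List α} (hl : l ≠ []) (hu : u <:+: l) : 0 < occ l u := by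
  induction l with
  | nil => exact absurd rfl hl
  | cons b l ih =>
    rw [occ_cons]
    rcases List.infix_cons_iff.1 hu with h | h
    · simp [h]
    · by_cases hl : l = []
      · subst hl
        rw [List.infix_nil] at h
        simp [h]
      · have := ih hl h
        omega

lemma occ_le_of_prefix {l u v : List α} (h : u <+: v) : occ l v ≤ occ l u := by
  unfold occ
  exact Finset.card_le_card (Finset.monotone_filter_right _ fun i _ hi => h.trans hi)

/-- Each occurrence of `u` is followed by at most one letter; the inequality is due to an occurrence
at the end of `l`. -/
lemma sum_occ_append_singleton_le [Fintype α] (l u : List α) :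
    ∑ a, occ l (u ++ [a]) ≤ occ l u := by
  induction l with
  | nil => simp [occ_nil]
  | cons b l ih =>
    simp only [occ_cons, Finset.sum_add_distrib]
    refine add_le_add ?_ ih
    by_cases hu : u <+: b :: l
    · rw [if_pos hu, ← Finset.card_filter, Finset.card_le_one]
      intro c hc d hd
      simp only [Finset.mem_filter, Finset.mem_univ, true_and] at hc hd
      have h := (List.prefix_of_prefix_length_le hc hd (by simp)).eq_of_length (by simp)
      simpa using h
    · rw [if_neg hu]
      refine le_of_eq (Finset.sum_eq_zero fun a _ => if_neg fun h => hu ?_)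
      exact (List.prefix_append _ _).trans h

end Occurrences

/-! ### The cost of the windows of a word -/

section WindowCost

variable {α : Type u}

/-- The sum of `φ` over the factors of length `k + 1`, counted by position. -/
noncomputable def windowCost (φ : List α → ℝ) (k : ℕ) : List α → ℝ
  | [] => 0
  | a :: l => (if k < (a :: l).length then φ ((a :: l).take (k + 1)) else 0) + windowCost φ k l

variable {φ : List α → ℝ} {k : ℕ}

lemma windowCost_nonneg (hφ : ∀ u, 0 ≤ φ u) (l : List α) : 0 ≤ windowCost φ k l := by
  induction l with
  | nil => exact le_rfl
  | cons a l ih =>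
    rw [windowCost]
    split_ifs
    · exact add_nonneg (hφ _) ih
    · simpa using ih

/-- Windows across the boundary only add nonnegative costs. -/
lemma windowCost_append_le (hφ : ∀ u, 0 ≤ φ u) (l m : List α) :
    windowCost φ k l + windowCost φ k m ≤ windowCost φ k (l ++ m) := by
  induction l with
  | nil => simp [windowCost]
  | cons a l ih =>
    rw [List.cons_append, windowCost, windowCost]
    by_cases h : k < (a :: l).length
    · have h' : k < (a :: (l ++ m)).length := by
        simp only [List.length_cons, List.length_append] at h ⊢
        omega
      have ht : (a :: (l ++ m)).take (k + 1) = (a :: l).take (k + 1) := by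
        rw [← List.cons_append, List.take_append_of_le_length (by omega)]
      rw [if_pos h, if_pos h', ht]
      linarith
    · rw [if_neg h]
      have : 0 ≤ if k < (a :: (l ++ m)).length then φ ((a :: (l ++ m)).take (k + 1)) else 0 := by
        split_ifs
        · exact hφ _
        · exact le_rfl
      linarith

lemma sum_windowCost_le {β : Type*} (hφ : ∀ u, 0 ≤ φ u) (f : β → List α) (T : List β) :
    (T.map fun y => windowCost φ k (f y)).sum ≤ windowCost φ k (T.flatMap f) := by
  induction T with
  | nil => simp [windowCost]
  | cons y T ih =>
    rw [List.map_cons, List.sum_cons, List.flatMap_cons]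
    have := windowCost_append_le (k := k) hφ (f y) (T.flatMap f)
    linarith

/-- Groups the windows by their content, a context of length `k` and the letter after it. -/
lemma windowCost_eq_sum_le [DecidableEq α] (hφ : ∀ u, 0 ≤ φ u) (A : Finset α) (l : List α)
    (hl : ∀ a ∈ l, a ∈ A) :
    windowCost φ k l ≤ ∑ v ∈ Fintype.piFinset (fun _ : Fin k => A), ∑ a ∈ A,
      (occ l (List.ofFn v ++ [a]) : ℝ) * φ (List.ofFn v ++ [a]) := by
  induction l with
  | nil => simp [windowCost, occ_nil]
  | cons b l ih =>
    have ih' := ih fun a ha => hl a (by simp [ha])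
    rw [windowCost]
    simp only [occ_cons, Nat.cast_add, add_mul, Finset.sum_add_distrib]
    refine add_le_add ?_ ih'
    have hnn : ∀ u : List α, 0 ≤ ((if u <+: b :: l then 1 else 0 : ℕ) : ℝ) * φ u :=
      fun u => mul_nonneg (Nat.cast_nonneg _) (hφ u)
    split_ifs with hk
    · set w := (b :: l).take (k + 1) with hw
      have hwl : w.length = k + 1 := by
        rw [hw, List.length_take]
        omega
      have hwp : w <+: b :: l := List.take_prefix _ _
      have hwA : ∀ i (hi : i < w.length), w[i] ∈ A := fun i hi =>
        hl _ (hwp.subset (List.getElem_mem hi))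
      set v : Fin k → α := fun i => w[i.1]'(by omega) with hv
      have hvw : List.ofFn v ++ [w[k]'(by omega)] = w := by
        refine List.ext_getElem (by simp [hwl]) fun i h1 h2 => ?_
        by_cases hi : i < k
        · rw [List.getElem_append_left (by simpa using hi)]
          simp [hv]
        · have : i = k := by omega
          subst this
          rw [List.getElem_append_right (by simp)]
          simp
      have hvA : v ∈ Fintype.piFinset (fun _ : Fin k => A) := by
        simp only [Fintype.mem_piFinset]
        exact fun i => hwA _ _
      refine le_trans ?_ (Finset.single_le_sum (fun v _ => Finset.sum_nonneg fun a _ => hnn _) hvA)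
      refine le_trans ?_ (Finset.single_le_sum (fun a _ => hnn _) (hwA k (by omega)))
      rw [hvw, if_pos hwp]
      simp
    · exact Finset.sum_nonneg fun v _ => Finset.sum_nonneg fun a _ => hnn _

end WindowCost

/-! ### Empirical entropy and codes -/

section Codes

variable {α : Type u} [DecidableEq α]

lemma length_mul_empiricalEntropy_zero (R : List α) :
    (R.length : ℝ) * empiricalEntropy 0 R =
      -∑ a ∈ R.toFinset, (R.count a : ℝ) * Real.logb 2 (R.count a / R.length) := by
  by_cases hR : R = []
  · simp [hR]
  have h0 : (R.length : ℝ) ≠ 0 := by simpa using hR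
  unfold empiricalEntropy
  rw [Fintype.piFinset_of_isEmpty, Fintype.sum_unique]
  simp only [List.ofFn_zero, List.nil_append, occ_singleton, occ_empty_word]
  field_simp

/-- Gibbs' inequality: no code is shorter than the entropy. -/
lemma length_mul_empiricalEntropy_zero_le (R : List α) (p : α → ℝ) (hp : ∀ a ∈ R, 0 < p a)
    (hsum : ∑ a ∈ R.toFinset, p a ≤ 1) :
    (R.length : ℝ) * empiricalEntropy 0 R ≤ (R.map fun a => -Real.logb 2 (p a)).sum := by
  rw [length_mul_empiricalEntropy_zero, Finset.sum_list_map_count, ← sub_nonneg, sub_neg_eq_add,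
    ← Finset.sum_add_distrib]
  by_cases hR : R = []
  · simp [hR]
  have hn : (0 : ℝ) < R.length := by
    exact_mod_cast List.length_pos_of_ne_nil hR
  have hl2 : 0 < Real.log 2 := Real.log_pos one_lt_two
  -- This is `log t ≤ t - 1` at `t = |R| p(a) / count(a)`; the left sides sum to a nonnegative
  -- number.
  have hterm : ∀ a ∈ R.toFinset, ((R.count a : ℝ) - R.length * p a) / Real.log 2 ≤
      R.count a • -Real.logb 2 (p a) + R.count a * Real.logb 2 (R.count a / R.length) := by
    intro a ha
    rw [List.mem_toFinset] at ha
    have hc : (0 : ℝ) < R.count a := by exact_mod_cast List.count_pos_iff.2 ha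
    have hpa := hp a ha
    have hlog := Real.log_le_sub_one_of_pos (div_pos (mul_pos hn hpa) hc)
    rw [Real.log_div (mul_pos hn hpa).ne' hc.ne', Real.log_mul hn.ne' hpa.ne'] at hlog
    have h1 := mul_le_mul_of_nonneg_left hlog hc.le
    have h2 : (R.count a : ℝ) * (R.length * p a / R.count a - 1) =
        R.length * p a - R.count a := by field_simp
    rw [nsmul_eq_mul, Real.logb, Real.logb, Real.log_div hc.ne' hn.ne',
      div_le_iff₀ hl2, add_mul, mul_assoc, mul_assoc, neg_mul, div_mul_cancel₀ _ hl2.ne',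
      div_mul_cancel₀ _ hl2.ne']
    rw [h2] at h1
    linarith
  refine le_trans ?_ (Finset.sum_le_sum hterm)
  rw [← Finset.sum_div]
  refine div_nonneg ?_ hl2.le
  rw [Finset.sum_sub_distrib, ← Finset.mul_sum, ← Nat.cast_sum, List.sum_toFinset_count_eq_length]
  nlinarith

end Codes

/-! ### A sequential model of words -/

section Model

variable {Γ : Type u} [DecidableEq Γ] (S : List Γ) (k : ℕ)

/-- The number of bits by which the empirical distribution of the letters of `S` after a given
context encodes the last letter of `u`, in the context of the other letters. -/
noncomputable def contextCost (u : List Γ) : ℝ :=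
  -Real.logb 2 ((occ S u : ℝ) / occ S u.dropLast)

lemma contextCost_nonneg (u : List Γ) : 0 ≤ contextCost S u := by
  rw [contextCost, neg_nonneg]
  refine Real.logb_nonpos one_lt_two (by positivity) (div_le_one_of_le₀ ?_ (by positivity))
  exact_mod_cast occ_le_of_prefix (List.dropLast_prefix u)

lemma windowCost_contextCost_le :
    windowCost (contextCost S) k S ≤ S.length * empiricalEntropy k S := by
  by_cases hS : S = []
  · simp [hS, windowCost]
  have h0 : (S.length : ℝ) ≠ 0 := by simpa using hS
  refine (windowCost_eq_sum_le (contextCost_nonneg S) S.toFinset S (by simp)).trans (le_of_eq ?_)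
  unfold empiricalEntropy
  rw [← mul_assoc, mul_neg, mul_one_div_cancel h0, neg_one_mul]
  simp only [contextCost, List.dropLast_concat, mul_neg, Finset.sum_neg_distrib]

variable [Fintype Γ] (θ : ℝ)

/-- The probability of the word in the last argument in the model which, after the last at most
`k` letters `h`, stops with probability `1 - θ`, and otherwise generates a letter: uniformly if `h`
is shorter than `k`, and else with the empirical distribution of the letters of `S` after `h`. -/
noncomputable def modelProb : List Γ → List Γ → ℝ
  | _, [] => 1 - θ
  | h, a :: v =>
    if h.length < k then θ * (Fintype.card Γ : ℝ)⁻¹ * modelProb (h ++ [a]) v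
    else θ * ((occ S (h ++ [a]) : ℝ) / occ S h) * modelProb (h ++ [a]).tail v

variable {θ}

lemma modelProb_nonneg (hθ0 : 0 < θ) (hθ1 : θ < 1) (h v : List Γ) : 0 ≤ modelProb S k θ h v := by
  induction v generalizing h with
  | nil =>
    rw [modelProb]
    linarith
  | cons a v ih =>
    rw [modelProb]
    have := ih (h ++ [a])
    have := ih (h ++ [a]).tail
    split_ifs <;> positivity

/-- The model stops with weight `1 - θ` or passes weight at most `θ` on to the next letter, so no
mass is gained; the length bound keeps the sum finite. -/
lemma sum_modelProb_le (hθ0 : 0 < θ) (N : ℕ) (h : List Γ) :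
    ∑ v ∈ wordsUpTo Γ N, modelProb S k θ h v ≤ 1 := by
  induction N generalizing h with
  | zero =>
    simp only [wordsUpTo, Finset.sum_singleton, modelProb]
    linarith
  | succ N ih =>
    rw [sum_wordsUpTo_succ]
    simp only [modelProb]
    suffices hs : ∀ q : Γ → ℝ, (∀ a, 0 ≤ q a) → ∑ a, q a ≤ 1 → ∀ t : Γ → List Γ,
        1 - θ + ∑ a, ∑ v ∈ wordsUpTo Γ N, θ * q a * modelProb S k θ (t a) v ≤ 1 by
      split_ifs with hk
      · refine hs (fun _ => (Fintype.card Γ : ℝ)⁻¹) (fun _ => by positivity) ?_ _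
        simp only [Finset.sum_const, Finset.card_univ, nsmul_eq_mul]
        exact mul_inv_le_one
      · refine hs (fun a => (occ S (h ++ [a]) : ℝ) / occ S h) (fun _ => by positivity) ?_ _
        rw [← Finset.sum_div]
        refine div_le_one_of_le₀ ?_ (by positivity)
        exact_mod_cast sum_occ_append_singleton_le S h
    intro q hq hq1 t
    have : ∀ a, ∑ v ∈ wordsUpTo Γ N, θ * q a * modelProb S k θ (t a) v ≤ θ * q a := by
      intro a
      rw [← Finset.mul_sum]
      exact mul_le_of_le_one_right (mul_nonneg hθ0.le (hq a)) (ih _)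
    have h2 := Finset.sum_le_sum fun a (_ : a ∈ Finset.univ) => this a
    rw [← Finset.mul_sum] at h2
    nlinarith

/-- Until the context has `k` letters each letter costs `log σ`; afterwards it costs exactly its
window. Positivity holds because all windows occur in `S`. -/
lemma modelProb_pos_and_le (hθ0 : 0 < θ) (hθ1 : θ < 1) (h v : List Γ)
    (hh : h.length ≤ k) (hv : h ++ v <:+: S) :
    0 < modelProb S k θ h v ∧ -Real.logb 2 (modelProb S k θ h v) ≤
      -Real.logb 2 (1 - θ) + v.length * -Real.logb 2 θ +
        ((k : ℝ) - h.length) * Real.logb 2 (Fintype.card Γ) +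
        windowCost (contextCost S) k (h ++ v) := by
  induction v generalizing h with
  | nil =>
    rw [modelProb]
    refine ⟨by linarith, ?_⟩
    have h1 : 0 ≤ ((k : ℝ) - h.length) * Real.logb 2 (Fintype.card Γ) := by
      refine mul_nonneg (sub_nonneg.2 (by exact_mod_cast hh)) (div_nonneg ?_ ?_)
      · exact Real.log_natCast_nonneg _
      · exact Real.log_nonneg one_le_two
    have h2 := windowCost_nonneg (k := k) (contextCost_nonneg S) (h ++ [])
    simp only [List.length_nil, Nat.cast_zero, zero_mul, add_zero]
    linarith
  | cons a v ih =>
    have hS : S ≠ [] := by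
      rintro rfl
      simp at hv
    rw [modelProb]
    split_ifs with hk
    · have hc : (0 : ℝ) < (Fintype.card Γ : ℝ) := by
        exact_mod_cast Fintype.card_pos_iff.2 ⟨a⟩
      obtain ⟨h1, h2⟩ := ih (h ++ [a]) (by simpa using hk) (by simpa using hv)
      refine ⟨by positivity, ?_⟩
      rw [Real.logb_mul (by positivity) h1.ne', Real.logb_mul hθ0.ne' (by positivity),
        Real.logb_inv]
      simp only [List.append_assoc, List.singleton_append, List.length_append, List.length_cons,
        List.length_nil, Nat.cast_add, Nat.cast_one, zero_add] at h2 ⊢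
      linarith
    · have hhk : h.length = k := by omega
      have hne : h ++ [a] ≠ [] := by simp
      have hdec := List.cons_head_tail hne
      have hsuf : (h ++ [a]).tail ++ v <:+: S := by
        refine List.IsInfix.trans ?_ hv
        refine (List.IsSuffix.isInfix ⟨[(h ++ [a]).head hne], ?_⟩)
        rw [List.singleton_append, ← List.cons_append, hdec]
        simp
      obtain ⟨h1, h2⟩ := ih (h ++ [a]).tail (by simp [hhk]) hsuf
      have ho1 : (0 : ℝ) < occ S (h ++ [a]) := by
        exact_mod_cast occ_pos hS (List.IsInfix.trans ⟨[], v, by simp⟩ hv)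
      have ho2 : (0 : ℝ) < occ S h := by
        exact_mod_cast occ_pos hS (List.IsInfix.trans ⟨[], a :: v, by simp⟩ hv)
      refine ⟨by positivity, ?_⟩
      have hK : windowCost (contextCost S) k (h ++ a :: v) =
          contextCost S (h ++ [a]) +
            windowCost (contextCost S) k ((h ++ [a]).tail ++ v) := by
        have : h ++ a :: v = (h ++ [a]).head hne :: ((h ++ [a]).tail ++ v) := by
          rw [← List.cons_append, hdec]
          simp
        rw [this, windowCost, if_pos, ← List.cons_append, hdec,
          List.take_append_of_le_length (by simp [hhk]), List.take_of_length_le (by simp [hhk])]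
        simp [hhk]
      rw [hK, contextCost, List.dropLast_concat,
        Real.logb_mul (by positivity) h1.ne', Real.logb_mul hθ0.ne' (by positivity)]
      have hl : ((h ++ [a]).tail.length : ℝ) = h.length := by simp
      rw [hl] at h2
      simp only [List.length_cons, Nat.cast_add, Nat.cast_one]
      linarith

end Model

/-! ### Entropy coding of a grammar -/

namespace FullGrammar

variable {Γ : Type u} [Fintype Γ] [DecidableEq Γ] {S : List Γ} {g : FullGrammar Γ}
  {e : ℕ → List Γ}

lemma infix_flatMap_of_mem {α β : Type*} (f : α → List β) {T : List α} {y : α} (hy : y ∈ T) :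
    f y <:+: T.flatMap f := by
  obtain ⟨A, B, rfl⟩ := List.append_of_mem hy
  exact ⟨A.flatMap f, B.flatMap f, by simp⟩

/-- The entropy coding of a grammar in terms of the empirical entropy of the word. -/
lemma Parses.entropyCodingBits_le (h : Parses S g e) (hs : 0 < g.size) (k : ℕ) {θ : ℝ}
    (hθ0 : 0 < θ) (hθ1 : θ < 1) :
    g.entropyCodingBits ≤ S.length * empiricalEntropy k S + 2 * g.size +
      g.size * -Real.logb 2 (1 - θ) + S.length * -Real.logb 2 θ +
      g.size * (k * Real.logb 2 (Fintype.card Γ)) +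
      g.numNonterminals * Real.logb 2 g.size := by
  obtain ⟨T, hT, hperm⟩ := h.exists_unfolding
  have hs' : (0 : ℝ) < g.size := by exact_mod_cast hs
  have hs1 : (1 : ℝ) ≤ g.size := by exact_mod_cast hs
  have hTs : T.length + g.rules.length = g.size := by
    have := hperm.length_eq
    rwa [List.length_append, List.length_map, List.length_range] at this
  set W : Symbol Γ → ℝ := fun y => modelProb S k θ [] (expand e y) with hW
  have hW0 : ∀ y, 0 ≤ W y := fun y => modelProb_nonneg S k hθ0 hθ1 _ _
  -- Halving costs one bit per symbol. The part `W` serves the symbols of `T`, the uniform part the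
  -- extra copies, whose windows `T` has already used up.
  set p : Symbol Γ → ℝ := fun y => (W y + (g.size : ℝ)⁻¹) / 2 with hp
  have hp0 : ∀ y, 0 < p y := fun y => by
    have := hW0 y
    simp only [hp]
    positivity
  have hWsum : ∑ y ∈ g.rhs.toFinset, W y ≤ 1 := by
    obtain ⟨N, hN⟩ : ∃ N, ∀ y ∈ g.rhs.toFinset, (expand e y).length ≤ N :=
      ⟨g.rhs.toFinset.sup fun y => (expand e y).length, fun y hy =>
        Finset.le_sup (f := fun y => (expand e y).length) hy⟩
    refine le_trans ?_ (sum_modelProb_le S k hθ0 N [])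
    -- Uniqueness of parses enters here: a total weight at most one on words bounds the one on
    -- symbols.
    have hinj : Set.InjOn (expand e) g.rhs.toFinset := by
      intro x hx y hy hxy
      exact h.expand_injOn (by simpa using hx) (by simpa using hy) hxy
    rw [← Finset.sum_image (f := fun v => modelProb S k θ [] v) hinj]
    refine Finset.sum_le_sum_of_subset_of_nonneg ?_ fun v _ _ => modelProb_nonneg S k hθ0 hθ1 _ _
    intro v hv
    obtain ⟨y, hy, rfl⟩ := Finset.mem_image.1 hv
    exact mem_wordsUpTo N _ (hN y hy)
  have hpsum : ∑ y ∈ g.rhs.toFinset, p y ≤ 1 := by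
    simp only [hp]
    rw [← Finset.sum_div, Finset.sum_add_distrib, Finset.sum_const, nsmul_eq_mul]
    have hc : ((g.rhs.toFinset.card : ℕ) : ℝ) * (g.size : ℝ)⁻¹ ≤ 1 := by
      rw [← div_eq_mul_inv]
      refine div_le_one_of_le₀ ?_ hs'.le
      exact_mod_cast g.rhs.toFinset_card_le
    linarith
  have hG := length_mul_empiricalEntropy_zero_le g.rhs p (fun y _ => hp0 y) hpsum
  rw [← (hperm.map _).sum_eq, List.map_append, List.sum_append] at hG
  have hlogp : ∀ y q, 0 < q → q ≤ W y + (g.size : ℝ)⁻¹ →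
      -Real.logb 2 (p y) ≤ 1 + -Real.logb 2 q := by
    intro y q hq hqp
    have h1 := Real.logb_le_logb_of_le one_lt_two (by positivity) (div_le_div_of_nonneg_right hqp
      two_pos.le)
    rw [Real.logb_div hq.ne' two_ne_zero, Real.logb_self_eq_one one_lt_two] at h1
    simp only [hp]
    linarith
  have hnew : ((((List.range g.rules.length).map Sum.inr).map
      fun y : Symbol Γ => -Real.logb 2 (p y)).sum) ≤
      g.rules.length * (1 + Real.logb 2 g.size) := by
    refine (List.sum_le_card_nsmul _ (1 + Real.logb 2 g.size) ?_).trans (by simp [mul_add])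
    intro x hx
    obtain ⟨y, -, rfl⟩ := List.mem_map.1 hx
    have := hlogp y (g.size : ℝ)⁻¹ (by positivity) (by linarith [hW0 y])
    rwa [Real.logb_inv, neg_neg] at this
  have hold : (T.map fun y => -Real.logb 2 (p y)).sum ≤
      T.length * (1 + -Real.logb 2 (1 - θ) + k * Real.logb 2 (Fintype.card Γ)) +
      S.length * -Real.logb 2 θ + S.length * empiricalEntropy k S := by
    have h1 : (T.map fun y => -Real.logb 2 (p y)).sum ≤
        (T.map fun y => (1 + -Real.logb 2 (1 - θ) + k * Real.logb 2 (Fintype.card Γ)) +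
          ((expand e y).length * -Real.logb 2 θ +
            windowCost (contextCost S) k (expand e y))).sum := by
      refine List.sum_le_sum fun y hy => ?_
      have hin : [] ++ expand e y <:+: S := by
        rw [← hT, List.nil_append]
        exact infix_flatMap_of_mem _ hy
      obtain ⟨hpos, hle⟩ := modelProb_pos_and_le S k hθ0 hθ1 [] (expand e y) (by simp) hin
      have := hlogp y (W y) hpos (by linarith [inv_pos.2 hs'])
      simp only [List.nil_append, List.length_nil, Nat.cast_zero, sub_zero] at hle
      simp only [hW] at this
      linarith
    refine h1.trans ?_
    have h2 : ∀ T : List (Symbol Γ), (T.map fun y =>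
        (1 + -Real.logb 2 (1 - θ) + k * Real.logb 2 (Fintype.card Γ)) +
          ((expand e y).length * -Real.logb 2 θ +
            windowCost (contextCost S) k (expand e y))).sum =
        T.length * (1 + -Real.logb 2 (1 - θ) + k * Real.logb 2 (Fintype.card Γ)) +
          (T.flatMap (expand e)).length * -Real.logb 2 θ +
          (T.map fun y => windowCost (contextCost S) k (expand e y)).sum := by
      intro T
      induction T with
      | nil => simp
      | cons y T ih =>
        rw [List.map_cons, List.sum_cons, ih, List.map_cons, List.sum_cons, List.flatMap_cons,
          List.length_append, List.length_cons]
        push_cast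
        ring
    rw [h2, hT]
    have h3 := sum_windowCost_le (k := k) (contextCost_nonneg S) (expand e) T
    rw [hT] at h3
    have h4 := windowCost_contextCost_le S k
    linarith
  have hrules : ((g.rules.map List.length).sum : ℝ) ≤ g.size := by
    have : (g.rules.map List.length).sum ≤ g.size := by
      simp [size, rhs]
    exact_mod_cast this
  have hlogσ : 0 ≤ (k : ℝ) * Real.logb 2 (Fintype.card Γ) :=
    mul_nonneg (Nat.cast_nonneg _)
      (div_nonneg (Real.log_natCast_nonneg _) (Real.log_nonneg one_le_two))
  have hlogθ : 0 ≤ -Real.logb 2 (1 - θ) :=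
    neg_nonneg.2 (Real.logb_nonpos one_lt_two (by linarith) (by linarith))
  have hcast : (T.length : ℝ) + g.rules.length = g.size := by exact_mod_cast hTs
  have hTle : (T.length : ℝ) ≤ g.size := by
    have : (0 : ℝ) ≤ g.rules.length := Nat.cast_nonneg _
    linarith
  have h5 := mul_le_mul_of_nonneg_right hTle hlogθ
  have h6 := mul_le_mul_of_nonneg_right hTle hlogσ
  unfold entropyCodingBits numNonterminals
  linarith

end FullGrammar

/-! ### Executions of Greedy -/

namespace FullGrammar

variable {Γ : Type u} [DecidableEq Γ] {S : List Γ} {g : ℕ → FullGrammar Γ}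

lemma Replaceable.size_replace_le {g : FullGrammar Γ} {w : List (Symbol Γ)}
    (hw : g.Replaceable w) : (g.replace w).size ≤ g.size := by
  have h1 := size_replace g w
  have h2 := Nat.mul_le_mul_right (w.length - 1) hw.2
  have h3 := hw.1
  omega

lemma IsGreedyRun.exists_parses (h : IsGreedyRun S g) (i : ℕ) : ∃ e, Parses S (g i) e := by
  induction i with
  | zero => exact ⟨_, h.1 ▸ parses_initial S⟩
  | succ i ih =>
    obtain ⟨e, he⟩ := ih
    rcases h.2 i with ⟨w, hw, hg, -⟩ | ⟨-, hg⟩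
    · exact ⟨_, hg ▸ he.replace hw⟩
    · exact ⟨e, hg ▸ he⟩

lemma IsGreedyRun.size_succ_le (h : IsGreedyRun S g) (i : ℕ) :
    (g (i + 1)).size ≤ (g i).size := by
  rcases h.2 i with ⟨w, hw, hg, -⟩ | ⟨-, hg⟩
  · exact hg ▸ hw.size_replace_le
  · rw [hg]

lemma IsGreedyRun.size_zero (h : IsGreedyRun S g) : (g 0).size = S.length := by
  rw [h.1]
  simp [initial, size, rhs]

lemma IsGreedyRun.size_le (h : IsGreedyRun S g) (i : ℕ) : (g i).size ≤ S.length := by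
  induction i with
  | zero => exact h.size_zero.le
  | succ i ih => exact (h.size_succ_le i).trans ih

lemma IsGreedyRun.size_pos (h : IsGreedyRun S g) (hS : S ≠ []) (i : ℕ) : 0 < (g i).size := by
  obtain ⟨e, he⟩ := h.exists_parses i
  have hne : (g i).start ≠ [] := by
    intro h0
    have := he.start_eq
    rw [h0] at this
    exact hS this.symm
  have := List.length_pos_of_ne_nil hne
  simp only [size, rhs, List.length_append]
  omega

lemma IsGreedyRun.numNonterminals_succ_le (h : IsGreedyRun S g) (i : ℕ) :
    (g (i + 1)).numNonterminals ≤ (g i).numNonterminals + 1 := by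
  rcases h.2 i with ⟨w, -, hg, -⟩ | ⟨-, hg⟩
  · rw [hg]
    simp [numNonterminals, replace]
  · rw [hg]
    omega

lemma IsGreedyRun.numNonterminals_le (h : IsGreedyRun S g) (i : ℕ) :
    (g i).numNonterminals ≤ i := by
  induction i with
  | zero =>
    rw [h.1]
    simp [initial, numNonterminals]
  | succ i ih => exact (h.numNonterminals_succ_le i).trans (by omega)

/-- A round of Greedy gains at least as much as the replacement of any pair. -/
lemma IsGreedyRun.frequency_pair_le (h : IsGreedyRun S g) (i : ℕ) (a b : Symbol Γ) :
    (g i).frequency [a, b] ≤ (g i).size + 2 - (g (i + 1)).size := by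
  have hle := h.size_succ_le i
  by_cases hf : 2 ≤ (g i).frequency [a, b]
  · have hr : (g i).Replaceable [a, b] := ⟨by simp, hf⟩
    rcases h.2 i with ⟨w, -, hg, hmin⟩ | ⟨hno, -⟩
    · have h1 := hmin _ hr
      have h2 := size_replace (g i) [a, b]
      rw [← hg] at h1
      simp only [List.length_cons, List.length_nil] at h2
      omega
    · exact absurd hr (hno _)
  -- A frequency below two is covered by the `+ 2`, as the size never grows. In particular the bound
  -- survives termination.
  · omega

end FullGrammar

/-! ### Estimates -/

section Estimates

/-- With `y = 2^(x/16) ≥ 1 + 0.043x`, AM-GM gives `y² ≥ 0.172x`; squaring gives `y⁴ ≥ x` for `x ≥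
64`, and `2^x = (y⁴)⁴`. -/
lemma pow_four_le_two_rpow {x : ℝ} (hx : 64 ≤ x) : x ^ 4 ≤ (2 : ℝ) ^ x := by
  have h1 : 1 + x / 16 * Real.log 2 ≤ (2 : ℝ) ^ (x / 16) := by
    rw [Real.rpow_def_of_pos two_pos]
    have := Real.add_one_le_exp (Real.log 2 * (x / 16))
    linarith
  have h2 := Real.log_two_gt_d9
  set y := (2 : ℝ) ^ (x / 16) with hy
  have h3 : 1 + 0.043 * x ≤ y := by nlinarith
  have h4 : 0.172 * x ≤ y ^ 2 := by nlinarith [sq_nonneg (0.043 * x - 1)]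
  have h5 : x ≤ (y ^ 2) ^ 2 := by nlinarith
  have h6 : (2 : ℝ) ^ x = ((y ^ 2) ^ 2) ^ 4 := by
    rw [← pow_mul, ← pow_mul, hy, ← Real.rpow_natCast, ← Real.rpow_mul two_pos.le]
    congr 1
    push_cast
    ring
  rw [h6]
  exact pow_le_pow_left₀ (by linarith) h5 4

/-- A large grammar with few nonterminals has a frequent pair. -/
lemma gain_of_large {n σ s r c F : ℕ} (hn : 2 ≤ n) (hσ : 2 ≤ σ)
    (hL : 64 ≤ Real.logb σ n) (hs : 64 * n / Real.logb σ n ≤ s)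
    (hr : (r : ℝ) ≤ Real.sqrt n * Real.logb σ n)
    (hc : c * ((⌊Real.logb σ n / 4⌋₊ - 1) + 1) ≤ n)
    (hF : s ≤ σ ^ (2 * ((⌊Real.logb σ n / 4⌋₊ - 1) + 1)) * (2 * F) + 2 * (c + r) + (r + 1)) :
    Real.sqrt n / Real.logb σ n + 2 ≤ F := by
  set x := Real.logb σ n with hx
  set q := Real.sqrt n with hq
  have hn0 : (0 : ℝ) < n := by exact_mod_cast (by omega : 0 < n)
  have hσ1 : (1 : ℝ) < σ := by exact_mod_cast (by omega : 1 < σ)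
  have hσ2 : (2 : ℝ) ≤ σ := by exact_mod_cast hσ
  have hx0 : 0 < x := by linarith
  have hq2 : q ^ 2 = n := Real.sq_sqrt hn0.le
  have hq0 : 0 < q := Real.sqrt_pos.2 hn0
  have hpow : (σ : ℝ) ^ x = n := Real.rpow_logb (by linarith) hσ1.ne' hn0
  have hfl : 1 ≤ ⌊x / 4⌋₊ := Nat.le_floor (by norm_num; linarith)
  rw [Nat.sub_add_cancel hfl] at hc hF
  set ℓ := ⌊x / 4⌋₊ with hℓ
  have hℓ1 : (ℓ : ℝ) ≤ x / 4 := Nat.floor_le (by positivity)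
  have hℓ2 : x / 4 < ℓ + 1 := Nat.lt_floor_add_one _
  have hx2 : x ^ 2 ≤ q := by
    have h1 : (2 : ℝ) ^ x ≤ σ ^ x := Real.rpow_le_rpow two_pos.le hσ2 hx0.le
    have h2 := pow_four_le_two_rpow hL
    refine Real.le_sqrt_of_sq_le ?_
    rw [← pow_mul, hpow.symm]
    exact h2.trans h1
  have hσq : (σ : ℝ) ^ (2 * ℓ) ≤ q := by
    refine Real.le_sqrt_of_sq_le ?_
    rw [← pow_mul, ← hpow, ← Real.rpow_natCast]
    refine Real.rpow_le_rpow_of_exponent_le hσ1.le ?_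
    push_cast
    linarith
  set z := q / x with hz
  have hqz : q = z * x := by rw [hz, div_mul_cancel₀ _ hx0.ne']
  have hz0 : 0 < z := by positivity
  have hzx : x ≤ z := by
    rw [hz, le_div_iff₀ hx0]
    nlinarith
  have hnz : (n : ℝ) / x = q * z := by
    rw [← hq2, hz]
    ring
  have hs' : 64 * (q * z) ≤ s := by
    rw [← hnz, ← mul_div_assoc]
    exact hs
  have hc' : (c : ℝ) ≤ 64 / 15 * (q * z) := by
    have h1 : (c : ℝ) * ℓ ≤ n := by exact_mod_cast hc
    -- From `ℓ > x/4 - 1` and `1 ≤ x/64`.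
    have h2 : 15 / 64 * x ≤ ℓ := by linarith
    have h3 : (c : ℝ) * (15 / 64 * x) ≤ n :=
      (mul_le_mul_of_nonneg_left h2 (Nat.cast_nonneg c)).trans h1
    rw [← hnz, ← mul_div_assoc, le_div_iff₀ hx0]
    linarith
  have hF' : (s : ℝ) ≤ q * (2 * F) + 2 * (c + r) + (r + 1) := by
    have h1 : (s : ℝ) ≤ (σ : ℝ) ^ (2 * ℓ) * (2 * F) + 2 * (c + r) + (r + 1) := by
      exact_mod_cast hF
    have h2 := mul_le_mul_of_nonneg_right hσq (by positivity : (0 : ℝ) ≤ 2 * F)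
    linarith
  have hqx : q * x ≤ q * z := mul_le_mul_of_nonneg_left hzx hq0.le
  have hq1 : 1 ≤ q := by nlinarith
  -- Of `64qz`, the terms `2c` and `3r` take at most `(128/15 + 3)qz < 14qz`, and the remaining `1`
  -- is at most `q`. Then `F ≥ 25z - 1/2 ≥ z + 2`.
  have h1 : q * (z * 50) ≤ q * (2 * F + 1) := by nlinarith
  have h2 := le_of_mul_le_mul_left h1 hq0
  linarith

lemma le_sqrt_mul_of_add_mul_le {i s n x : ℝ} (hn : 0 < n) (hx : 0 < x) (hs : 0 ≤ s)
    (h : s + i * (Real.sqrt n / x) ≤ n) : i ≤ Real.sqrt n * x := by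
  have h1 : i * (Real.sqrt n / x) ≤ Real.sqrt n * Real.sqrt n := by
    rw [Real.mul_self_sqrt hn.le]
    linarith
  rw [← mul_div_assoc, div_le_iff₀ hx, mul_comm, mul_assoc] at h1
  exact le_of_mul_le_mul_left h1 (Real.sqrt_pos.2 hn)

lemma neg_logb_one_sub_inv_le {x : ℝ} (hx : 0 < x) :
    -Real.logb 2 (1 - (x + 2)⁻¹) ≤ 2 / x := by
  have h1 : 1 - (x + 2)⁻¹ = ((x + 2) / (x + 1))⁻¹ := by
    field_simp
    ring
  have hl := Real.log_two_gt_d9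
  rw [h1, Real.logb_inv, neg_neg, Real.logb, div_le_iff₀ (by linarith)]
  refine (Real.log_le_sub_one_of_pos (by positivity)).trans ?_
  have h2 : (x + 2) / (x + 1) - 1 = 1 / (x + 1) := by
    field_simp
    ring
  have h3 : 1 / (x + 1) ≤ 1 / x := one_div_le_one_div_of_le hx (by linarith)
  have h4 : 1 / x * 1 ≤ 1 / x * (2 * Real.log 2) :=
    mul_le_mul_of_nonneg_left (by linarith) (by positivity)
  rw [h2]
  calc 1 / (x + 1) ≤ 1 / x * (2 * Real.log 2) := by linarith
    _ = 2 / x * Real.log 2 := by ring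

lemma logb_add_two_le {x : ℝ} (hx : 1 ≤ x) : Real.logb 2 (x + 2) ≤ 6 * Real.sqrt x := by
  have hl := Real.log_two_gt_d9
  have hs0 : 0 < Real.sqrt (x + 2) := Real.sqrt_pos.2 (by linarith)
  have h1 := Real.log_le_sub_one_of_pos hs0
  rw [Real.log_sqrt (by linarith)] at h1
  have h2 : Real.sqrt (x + 2) ≤ 1.8 * Real.sqrt x := by
    rw [Real.sqrt_le_left (by positivity), mul_pow, Real.sq_sqrt (by linarith)]
    linarith
  rw [Real.logb, div_le_iff₀ (by linarith)]
  have h3 := Real.sqrt_nonneg x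
  nlinarith

/-- The redundancy of the entropy coding per `n log₂ σ` bits. -/
noncomputable def redundancyRate (σ k : ℕ → ℕ) (n : ℕ) : ℝ :=
  130 / Real.logb 2 n + 384 / Real.sqrt (Real.logb 2 n) + 64 * (k n / Real.logb (σ n) n) +
    4 * (Real.logb 2 n ^ 2 / Real.sqrt n)

lemma tendsto_redundancyRate (σ k : ℕ → ℕ)
    (hk : (fun n : ℕ => (k n : ℝ)) =o[atTop] fun n : ℕ => Real.logb (σ n) n) :
    Tendsto (redundancyRate σ k) atTop (nhds 0) := by
  have hu : Tendsto (fun n : ℕ => Real.logb 2 n) atTop atTop :=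
    (Real.tendsto_logb_atTop one_lt_two).comp tendsto_natCast_atTop_atTop
  have h1 : Tendsto (fun n : ℕ => 130 / Real.logb 2 n) atTop (nhds 0) :=
    hu.const_div_atTop 130
  have h2 : Tendsto (fun n : ℕ => 384 / Real.sqrt (Real.logb 2 n)) atTop (nhds 0) :=
    (Real.tendsto_sqrt_atTop.comp hu).const_div_atTop 384
  have h3 := hk.tendsto_div_nhds_zero.const_mul 64
  have h4 : Tendsto (fun n : ℕ => Real.logb 2 n ^ 2 / Real.sqrt n) atTop (nhds 0) := by
    have h := ((isLittleO_log_rpow_rpow_atTop 2 (by norm_num : (0 : ℝ) < 1 / 2)).comp_tendsto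
      tendsto_natCast_atTop_atTop).tendsto_div_nhds_zero.const_mul ((Real.log 2 ^ 2)⁻¹)
    rw [mul_zero] at h
    refine h.congr fun n => ?_
    simp only [Function.comp_apply, Real.logb, Real.sqrt_eq_rpow, Real.rpow_two]
    rw [div_pow]
    ring
  have h5 := ((h1.add h2).add h3).add (h4.const_mul 4)
  simp only [mul_zero, add_zero] at h5
  exact h5

/-- In terms of `b = log₂ σ` and `u = log₂ n` the size is at most `64nb/u`. Hence `130 = 2·64 + 2`,
`384 = 64·6`, and the `4` comes from `√n log_σ n + 3 ≤ 4√n u`. -/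
lemma coding_estimate (σ k : ℕ → ℕ) {n s r : ℕ} (hn : 2 ≤ n) (hσ : 2 ≤ σ n)
    (hs0 : 0 < s) (hsn : s ≤ n) (hs : (s : ℝ) ≤ 64 * n / Real.logb (σ n) n)
    (hr : (r : ℝ) ≤ Real.sqrt n * Real.logb (σ n) n + 3) :
    2 * s + s * Real.logb 2 (Real.logb (σ n) n + 2) +
      n * (2 / Real.logb (σ n) n) + s * (k n * Real.logb 2 (σ n)) + r * Real.logb 2 s ≤
      n * Real.logb 2 (σ n) * redundancyRate σ k n := by
  unfold redundancyRate
  have hn2 : (2 : ℝ) ≤ n := by exact_mod_cast hn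
  have hσ2 : (2 : ℝ) ≤ σ n := by exact_mod_cast hσ
  have hs0' : (0 : ℝ) < s := by exact_mod_cast hs0
  have hl2 : 0 < Real.log 2 := Real.log_pos one_lt_two
  have hlσ : 0 < Real.log (σ n) := Real.log_pos (by linarith)
  set x := Real.logb (σ n) n with hx
  set u := Real.logb 2 n with hu
  set b := Real.logb 2 (σ n) with hb
  set q := Real.sqrt n with hq
  have hb1 : 1 ≤ b := by
    rw [hb, Real.le_logb_iff_rpow_le one_lt_two (by linarith)]
    simpa using hσ2
  have hu1 : 1 ≤ u := by
    rw [hu, Real.le_logb_iff_rpow_le one_lt_two (by linarith)]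
    simpa using hn2
  have hxu : x * b = u := by
    simp only [hx, hb, hu, Real.logb]
    field_simp
  have hx0 : 0 < x := by
    by_contra! h
    nlinarith
  have hxle : x ≤ u := by nlinarith
  have hq2 : q ^ 2 = n := Real.sq_sqrt (by linarith)
  have hq1 : 1 ≤ q := Real.one_le_sqrt.2 (by linarith)
  have hnx : (n : ℝ) / x = n * b / u := by
    rw [← hxu]
    field_simp
  have hs' : (s : ℝ) ≤ 64 * (n * b / u) := by
    rw [← hnx, ← mul_div_assoc]
    exact hs
  have t1 : (2 : ℝ) * s + n * (2 / x) ≤ n * b * (130 / u) := by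
    have h1 : (n : ℝ) * (2 / x) = 2 * (n * b / u) := by
      rw [← hnx]
      ring
    have h2 : n * b * (130 / u) = 130 * (n * b / u) := by ring
    rw [h1, h2]
    linarith
  have t2 : s * Real.logb 2 (x + 2) ≤ n * b * (384 / Real.sqrt u) := by
    have h1 : Real.logb 2 (x + 2) ≤ 6 * Real.sqrt u :=
      (Real.logb_le_logb_of_le one_lt_two (by linarith) (by linarith)).trans (logb_add_two_le hu1)
    have hsu : 0 < Real.sqrt u := Real.sqrt_pos.2 (by linarith)
    have hus : u = Real.sqrt u ^ 2 := (Real.sq_sqrt (by linarith)).symm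
    calc s * Real.logb 2 (x + 2) ≤ 64 * (n * b / u) * (6 * Real.sqrt u) :=
          mul_le_mul hs' h1 (Real.logb_nonneg one_lt_two (by linarith)) (by positivity)
      _ = n * b * (384 / Real.sqrt u) := by
          nth_rewrite 1 [hus]
          field_simp
          ring
  have t3 : (s : ℝ) * (k n * b) ≤ n * b * (64 * (k n / x)) := by
    have h1 := mul_le_mul_of_nonneg_right hs (by positivity : 0 ≤ (k n : ℝ) * b)
    refine h1.trans (le_of_eq ?_)
    ring
  have t4 : r * Real.logb 2 s ≤ n * b * (4 * (u ^ 2 / q)) := by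
    have h1 : Real.logb 2 s ≤ u :=
      Real.logb_le_logb_of_le one_lt_two hs0' (by exact_mod_cast hsn)
    have h2 : (r : ℝ) ≤ 4 * (q * u) := by nlinarith
    have h0 : 0 ≤ Real.logb 2 s :=
      Real.logb_nonneg one_lt_two (by exact_mod_cast hs0)
    calc r * Real.logb 2 s ≤ 4 * (q * u) * u := mul_le_mul h2 h1 h0 (by positivity)
      _ = n * 1 * (4 * (u ^ 2 / q)) := by
          rw [← hq2]
          field_simp
      _ ≤ n * b * (4 * (u ^ 2 / q)) := by gcongr
  nlinarith

end Estimates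

/-! ### Number of rounds with a large grammar -/

namespace FullGrammar

variable {Γ : Type u} [Fintype Γ] [DecidableEq Γ] {S : List Γ} {g : ℕ → FullGrammar Γ}

/-- As long as the grammar is large, every round gains at least `√n / log_σ n`. -/
lemma IsGreedyRun.size_add_le (h : IsGreedyRun S g) (hσ : 2 ≤ Fintype.card Γ)
    (hn : 2 ≤ S.length) (i : ℕ)
    (hlarge : ∀ j < i, 64 * (S.length : ℝ) / Real.logb (Fintype.card Γ) S.length ≤ (g j).size) :
    ((g i).size : ℝ) + i * (Real.sqrt S.length / Real.logb (Fintype.card Γ) S.length) ≤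
      S.length := by
  induction i with
  | zero => simp [h.size_zero]
  | succ i ih =>
    have ih' := ih fun j hj => hlarge j (by omega)
    have hσ1 : (1 : ℝ) < Fintype.card Γ := by exact_mod_cast hσ
    have hn1 : (1 : ℝ) < S.length := by exact_mod_cast hn
    -- The initial grammar has size `n`, so it is large only if `log_σ n ≥ 64`.
    have hL : 64 ≤ Real.logb (Fintype.card Γ) S.length := by
      have h0 := hlarge 0 (by omega)
      have hx : 0 < Real.logb (Fintype.card Γ) S.length := Real.logb_pos hσ1 hn1
      rw [h.size_zero, div_le_iff₀ hx] at h0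
      nlinarith
    obtain ⟨e, he⟩ := h.exists_parses i
    obtain ⟨c, hc, hle⟩ := he.size_le hσ _ (h.frequency_pair_le i)
      (⌊Real.logb (Fintype.card Γ) S.length / 4⌋₊ - 1)
    have hr : ((g i).rules.length : ℝ) ≤
        Real.sqrt S.length * Real.logb (Fintype.card Γ) S.length := by
      have h1 : ((g i).rules.length : ℝ) ≤ i := by exact_mod_cast h.numNonterminals_le i
      exact h1.trans (le_sqrt_mul_of_add_mul_le (by linarith) (by linarith)
        (Nat.cast_nonneg _) ih')
    have hgain := gain_of_large hn hσ hL (hlarge i (by omega)) hr hc hle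
    have hsz := h.size_succ_le i
    rw [Nat.cast_sub (by omega)] at hgain
    push_cast at hgain ⊢
    linarith

lemma IsGreedyRun.le_of_large (h : IsGreedyRun S g) (hσ : 2 ≤ Fintype.card Γ)
    (hn : 2 ≤ S.length) (i : ℕ)
    (hlarge : ∀ j < i, 64 * (S.length : ℝ) / Real.logb (Fintype.card Γ) S.length ≤ (g j).size) :
    (i : ℝ) ≤ Real.sqrt S.length * Real.logb (Fintype.card Γ) S.length := by
  have hσ1 : (1 : ℝ) < Fintype.card Γ := by exact_mod_cast hσ
  have hn1 : (1 : ℝ) < S.length := by exact_mod_cast hn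
  exact le_sqrt_mul_of_add_mul_le (by linarith) (Real.logb_pos hσ1 hn1) (Nat.cast_nonneg _)
    (h.size_add_le hσ hn i hlarge)

end FullGrammar

end GreedyGrammar

theorem mainTheorem7 (σ k : ℕ → ℕ) (hσ : ∀ n, 2 ≤ σ n)
    (hk : (fun n : ℕ => (k n : ℝ)) =o[atTop] fun n : ℕ => Real.logb (σ n) n) :
    ∃ err : ℕ → ℝ, (err =o[atTop] fun n : ℕ => (n : ℝ) * Real.logb 2 (σ n)) ∧
      ∀ n : ℕ, 2 ≤ n → ∀ (Γ : Type u) [Fintype Γ] [DecidableEq Γ], Fintype.card Γ = σ n →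
        ∀ S : List Γ, S.length = n →
          ∀ g : ℕ → GreedyGrammar.FullGrammar Γ, GreedyGrammar.FullGrammar.IsGreedyRun S g →
            (∃ i, ((g i).size : ℝ) < 64 * n / Real.logb (σ n) n) ∧
            ∀ i, IsLeast {j | ((g j).size : ℝ) < 64 * n / Real.logb (σ n) n} i →
              ((g i).numNonterminals : ℝ) ≤ Real.sqrt n * Real.logb (σ n) n + 3 ∧
              (g i).entropyCodingBits ≤
                (S.length : ℝ) * GreedyGrammar.empiricalEntropy (k n) S + err n := by
  refine ⟨fun n => (n : ℝ) * Real.logb 2 (σ n) * GreedyGrammar.redundancyRate σ k n, ?_, ?_⟩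
  · have h := (isBigO_refl (fun n : ℕ => (n : ℝ) * Real.logb 2 (σ n)) atTop).mul_isLittleO
      ((isLittleO_one_iff ℝ).2 (GreedyGrammar.tendsto_redundancyRate σ k hk))
    simpa using h
  · intro n hn Γ _ _ hcard S hS g hg
    have hσn : 2 ≤ Fintype.card Γ := hcard ▸ hσ n
    have hSn : 2 ≤ S.length := hS ▸ hn
    have hbound := hg.le_of_large hσn hSn
    rw [hcard, hS] at hbound
    refine ⟨?_, ?_⟩
    · by_contra! hall
      obtain ⟨i, hi⟩ := exists_nat_gt (Real.sqrt n * Real.logb (σ n) n)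
      exact absurd (hbound i fun j _ => hall j) (not_le.2 hi)
    · intro i hi
      have hx : 0 < Real.logb (σ n) n :=
        Real.logb_pos (by exact_mod_cast hσ n) (by exact_mod_cast hn)
      have hnt : ((g i).numNonterminals : ℝ) ≤ Real.sqrt n * Real.logb (σ n) n + 3 := by
        have h1 := hbound i fun j hj => not_lt.1 fun hlt => absurd (hi.2 hlt) (not_le.2 hj)
        have h2 : ((g i).numNonterminals : ℝ) ≤ i := by exact_mod_cast hg.numNonterminals_le i
        linarith
      refine ⟨hnt, ?_⟩
      have hSne : S ≠ [] := by
        rintro rfl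
        simp at hSn
      obtain ⟨e, he⟩ := hg.exists_parses i
      have hpos := hg.size_pos hSne i
      have hinv : (Real.logb (σ n) n + 2)⁻¹ < 1 := inv_lt_one_of_one_lt₀ (by linarith)
      -- This `θ` balances the stopping cost `log₂(log_σ n + 2)` per symbol against at most `2/log_σ
      -- n` bits per letter of `S`.
      have hcode := he.entropyCodingBits_le hpos (k n)
        (θ := 1 - (Real.logb (σ n) n + 2)⁻¹) (by linarith) (sub_lt_self _ (by positivity))
      have hest := GreedyGrammar.coding_estimate σ k hn (hσ n) hpos (hS ▸ hg.size_le i)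
        (le_of_lt hi.1) hnt
      have hθ := mul_le_mul_of_nonneg_left (GreedyGrammar.neg_logb_one_sub_inv_le hx)
        (Nat.cast_nonneg n)
      rw [sub_sub_cancel, Real.logb_inv, neg_neg, hcard, hS] at hcode
      rw [hS]
      linarith
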